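/- Let $d\in\mathbb N$ and let $X$ be a complex reflexive Banach space. Let $A=(A_1,\dots,A_d)$ and $B=(B_1,\dots,B_d)$ be a Weyl pair on $X$: the $A_j,B_j$ are closed densely defined operators in $X$ such that each $iA_j$ and $iB_j$ generates a uniformly bounded $C_0$-group $(e^{itA_j})_{t\in\mathbb R}$, respectively $(e^{itB_j})_{t\in\mathbb R}$, and for all $s,t\in\mathbb R$ and $1\le j,k\le d$ $$e^{isA_j}e^{itA_k}=e^{itA_k}e^{isA_j},\quad e^{isB_j}e^{itB_k}=e^{itB_k}e^{isB_j},\quad e^{isA_j}e^{itB_k}=e^{-ist\delta_{jk}}e^{itB_k}e^{isA_j}.$$ For $u,v\in\mathbb R^d$ put $e^{i(uA+vB)}:=e^{\frac12 i uv}\prod_{j=1}^d e^{iu_jA_j}\prod_{k=1}^d e^{iv_kB_k}$, where $uv=\sum_j u_jv_j$, and for a function $a$ on $\mathbb R^{2d}$ (Schwartz, or more generally such that the following $\widehat a$ is integrable) let $$a(A,B)f:=\frac1{(2\pi)^d}\int_{\mathbb R^{2d}}\widehat a(u,v)\,e^{i(uA+vB)}f\,du\,dv,\qquad \widehat a(u,v):=\frac1{(2\pi)^d}\int_{\mathbb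 R^{2d}}a(x,\xi)e^{-i(xu+\xi v)}\,dx\,d\xi .$$ For $t>0$ let $a_t(x,\xi):=(1+\lambda_t)^d e^{-\lambda_t(|x|^2+|\xi|^2)}$ with $\lambda_t=\frac{1-e^{-t}}{1+e^{-t}}$. Then: 1. The operator $\frac12\sum_{j=1}^d(A_j^2+B_j^2)-\frac12 d$ with domain $\bigcap_j (D(A_j^2)\cap D(B_j^2))$ is closable; if $L$ denotes its closure, then $-L$ is the generator of the family $(a_t(A,B))_{t>0}$, i.e. $f\in D(L)$ and $-Lf=g$ if and only if $\lim_{t\downarrow0}\frac1t(a_t(A,B)f-f)=g$ in $X$. 2. The limit $\pi:=\lim_{t\to\infty}a_t(A,B)$ exists in the weak operator topology of $\mathscr L(X)$. 3. $N(L)=R(\pi)$ and $\overline{R(L)}=N(\pi)$, where $N$ and $R$ denote null space and range. -/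

import Mathlib

open Filter Topology MeasureTheory

noncomputable section

/-- A complex normed space is reflexive if the canonical isometric embedding into its bidual is
surjective. -/
def IsReflexiveSpace (X : Type*) [NormedAddCommGroup X] [NormedSpace ℂ X] : Prop :=
  Function.Surjective (NormedSpace.inclusionInDoubleDual ℂ X)

section

variable {X : Type*} [NormedAddCommGroup X] [NormedSpace ℂ X]

/-- The (unbounded) operator `G` generates the uniformly bounded `C₀`-group `(U t)`, `t ∈ ℝ`.
The last field says that `f ∈ D(G)` and `G f = g` if and only if
`lim_{t → 0} (U t f - f) / t = g`. -/
structure GeneratesBoundedGroup (G : X →ₗ.[ℂ] X) (U : ℝ → X →L[ℂ] X) : Prop where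
  map_zero : U 0 = 1
  map_add : ∀ s t, U (s + t) = U s * U t
  continuous_orbit : ∀ f, Continuous fun t => U t f
  bounded : ∃ M : ℝ, ∀ t, ‖U t‖ ≤ M
  mem_graph_iff : ∀ f g, (f, g) ∈ G.graph ↔ HasDerivAt (fun t : ℝ => U t f) g 0

/-- `G` is the generator of the one-parameter family `(P t)`, `t > 0`, `P 0 = 1`:
`f ∈ D(G)` and `G f = g` if and only if `lim_{t ↓ 0} (P t f - f) / t = g`. -/
def IsGeneratorOf (G : X →ₗ.[ℂ] X) (P : ℝ → X →L[ℂ] X) : Prop :=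
  ∀ f g, (f, g) ∈ G.graph ↔
    Tendsto (fun t : ℝ => t⁻¹ • (P t f - f)) (𝓝[>] 0) (𝓝 g)

/-- The square `T²` of an unbounded operator, with domain `{f ∈ D(T) : T f ∈ D(T)}`. -/
def sqPMap (T : X →ₗ.[ℂ] X) : X →ₗ.[ℂ] X where
  domain := (T.domain.comap T.toFun).map T.domain.subtype
  toFun :=
    { toFun := fun f => T ⟨T ⟨f, by obtain ⟨y, -, hy⟩ := f.2; exact hy ▸ y.2⟩, by
        obtain ⟨_, y, hy, rfl⟩ := f; exact hy⟩
      map_add' := by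
        rintro ⟨_, x, hx, rfl⟩ ⟨_, y, hy, rfl⟩
        rw [← LinearPMap.map_add]
        congr 2
        exact LinearPMap.map_add T x y
      map_smul' := by
        rintro c ⟨_, x, hx, rfl⟩
        rw [← LinearPMap.map_smul]
        congr 2
        exact LinearPMap.map_smul T c x }

end

/-- A Weyl pair of dimension `d` on `X`: closed densely defined operators `A_j`, `B_j` such that
`i A_j`, `i B_j` generate uniformly bounded `C₀`-groups `expA j t = e^{i t A_j}` and
`expB j t = e^{i t B_j}` (these are uniquely determined by `A_j`, `B_j`) that satisfy the
integrated canonical commutation relations. -/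
structure WeylPair (d : ℕ) (X : Type*) [NormedAddCommGroup X] [NormedSpace ℂ X] where
  A : Fin d → (X →ₗ.[ℂ] X)
  B : Fin d → (X →ₗ.[ℂ] X)
  expA : Fin d → ℝ → X →L[ℂ] X
  expB : Fin d → ℝ → X →L[ℂ] X
  closed_A : ∀ j, (A j).IsClosed
  closed_B : ∀ j, (B j).IsClosed
  dense_A : ∀ j, Dense ((A j).domain : Set X)
  dense_B : ∀ j, Dense ((B j).domain : Set X)
  generates_A : ∀ j, GeneratesBoundedGroup (Complex.I • A j) (expA j)
  generates_B : ∀ j, GeneratesBoundedGroup (Complex.I • B j) (expB j)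
  comm_A : ∀ j k s t, expA j s * expA k t = expA k t * expA j s
  comm_B : ∀ j k s t, expB j s * expB k t = expB k t * expB j s
  ccr : ∀ (j k : Fin d) (s t : ℝ), expA j s * expB k t =
    Complex.exp (-Complex.I * s * t * (if j = k then 1 else 0)) • (expB k t * expA j s)

/-- The product `U_1(u_1) ⋯ U_d(u_d)`, i.e. `e^{i u A}` if `U_j(t) = e^{i t A_j}`. -/
def multiExp {d : ℕ} {X : Type*} [NormedAddCommGroup X] [NormedSpace ℂ X]
    (U : Fin d → ℝ → X →L[ℂ] X) (u : EuclideanSpace ℝ (Fin d)) : X →L[ℂ] X :=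
  ((List.finRange d).map fun j => U j (u j)).prod

theorem multiExp_bounded_continuous {d : ℕ} {X : Type*} [NormedAddCommGroup X] [NormedSpace ℂ X]
    (U : Fin d → ℝ → X →L[ℂ] X) (hb : ∀ j, ∃ M : ℝ, ∀ t, ‖U j t‖ ≤ M)
    (hc : ∀ j f, Continuous fun t => U j t f) :
    (∃ M : ℝ, ∀ u, ‖multiExp U u‖ ≤ M) ∧ ∀ f, Continuous fun u => multiExp U u f := by
  unfold multiExp
  induction List.finRange d with
  | nil => exact ⟨⟨‖(1 : X →L[ℂ] X)‖, by simp⟩, by simp [continuous_const]⟩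
  | cons j l ih =>
    obtain ⟨⟨M, hM⟩, ihc⟩ := ih
    obtain ⟨N, hN⟩ := hb j
    have hN0 : 0 ≤ N := (norm_nonneg _).trans (hN 0)
    refine ⟨⟨N * M, fun u => ?_⟩, fun f => ?_⟩
    · simp only [List.map_cons, List.prod_cons]
      exact (norm_mul_le _ _).trans (mul_le_mul (hN _) (hM u) (norm_nonneg _) hN0)
    · simp only [List.map_cons, List.prod_cons, mul_apply_eq_comp]
      rw [continuous_iff_continuousAt]
      intro u₀
      set g := (List.map (fun j => U j (u₀ j)) l).prod f with hg
      have h1 : Tendsto (fun u : EuclideanSpace ℝ (Fin d) => U j (u j) g) (𝓝 u₀)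
          (𝓝 (U j (u₀ j) g)) :=
        ((hc j g).comp (by fun_prop : Continuous fun u : EuclideanSpace ℝ (Fin d) => u j)).tendsto u₀
      have h2 : Tendsto (fun u : EuclideanSpace ℝ (Fin d) =>
          U j (u j) ((List.map (fun j => U j (u j)) l).prod f - g)) (𝓝 u₀) (𝓝 0) := by
        refine squeeze_zero_norm (a := fun u : EuclideanSpace ℝ (Fin d) =>
          N * ‖(List.map (fun j => U j (u j)) l).prod f - g‖)
          (fun u => (U j (u j)).le_of_opNorm_le (hN _) _) ?_
        have h3 := ((((ihc f).tendsto u₀).sub_const g).norm).const_mul N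
        simpa [hg] using h3
      have h4 := h1.add h2
      simpa [ContinuousAt] using h4

namespace WeylPair

variable {d : ℕ} {X : Type*} [NormedAddCommGroup X] [NormedSpace ℂ X] (W : WeylPair d X)

/-- `½ (A² + B²) - ½ d` on the domain `D(A²) ∩ D(B²)`, where `A² = ∑ A_j²`, `B² = ∑ B_j²` have
the domains `D(A²) = ⋂ D(A_j²)`, `D(B²) = ⋂ D(B_j²)` (a sum of partially defined operators
has the intersection of the domains as its domain). -/
def preL : X →ₗ.[ℂ] X :=
  (1 / 2 : ℂ) • (∑ j, sqPMap (W.A j) + ∑ j, sqPMap (W.B j))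
    - ((d / 2 : ℂ) • (LinearMap.id : X →ₗ[ℂ] X)).toPMap ⊤

/-- `L`, the closure of `½ (A² + B²) - ½ d`. -/
def L : X →ₗ.[ℂ] X := W.preL.closure

/-- `e^{i(uA + vB)} = e^{½ i u v} e^{iuA} e^{ivB}`. -/
def schrodinger (p : EuclideanSpace ℝ (Fin d) × EuclideanSpace ℝ (Fin d)) : X →L[ℂ] X :=
  Complex.exp (Complex.I / 2 * ((inner ℝ p.1 p.2 : ℝ) : ℂ)) •
    (multiExp W.expA p.1 * multiExp W.expB p.2)

theorem schrodinger_bounded : ∃ M : ℝ, ∀ p, ‖W.schrodinger p‖ ≤ M := by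
  obtain ⟨⟨M, hM⟩, -⟩ := multiExp_bounded_continuous W.expA
    (fun j => (W.generates_A j).bounded) fun j => (W.generates_A j).continuous_orbit
  obtain ⟨⟨N, hN⟩, -⟩ := multiExp_bounded_continuous W.expB
    (fun j => (W.generates_B j).bounded) fun j => (W.generates_B j).continuous_orbit
  refine ⟨M * N, fun p => ?_⟩
  have h1 : ‖Complex.exp (Complex.I / 2 * ((inner ℝ p.1 p.2 : ℝ) : ℂ))‖ = 1 := by
    rw [Complex.norm_exp]; simp [Complex.mul_re]
  rw [schrodinger, norm_smul, h1, one_mul]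
  exact (norm_mul_le _ _).trans
    (mul_le_mul (hM _) (hN _) (norm_nonneg _) ((norm_nonneg _).trans (hM p.1)))

theorem schrodinger_continuous (f : X) : Continuous fun p => W.schrodinger p f := by
  obtain ⟨⟨M, hM⟩, hA⟩ := multiExp_bounded_continuous W.expA
    (fun j => (W.generates_A j).bounded) fun j => (W.generates_A j).continuous_orbit
  obtain ⟨-, hB⟩ := multiExp_bounded_continuous W.expB
    (fun j => (W.generates_B j).bounded) fun j => (W.generates_B j).continuous_orbit
  simp only [schrodinger, smul_apply, mul_apply_eq_comp]
  refine Continuous.smul (by fun_prop) ?_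
  rw [continuous_iff_continuousAt]
  intro p₀
  set g := multiExp W.expB p₀.2 f with hg
  have h1 := ((hA g).comp continuous_fst).tendsto p₀
  have h2 : Tendsto (fun p : EuclideanSpace ℝ (Fin d) × EuclideanSpace ℝ (Fin d) =>
      multiExp W.expA p.1 (multiExp W.expB p.2 f - g)) (𝓝 p₀) (𝓝 0) := by
    refine squeeze_zero_norm (a := fun p => M * ‖multiExp W.expB p.2 f - g‖)
      (fun p => (multiExp W.expA p.1).le_of_opNorm_le (hM _) _) ?_
    have h3 := (((((hB f).comp continuous_snd).tendsto p₀).sub_const g).norm).const_mul M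
    simpa [hg] using h3
  have h4 := h1.add h2
  simpa [ContinuousAt] using h4

end WeylPair

/-- The Fourier--Plancherel transform
`â(u,v) = (2π)^{-d} ∫ a(x,ξ) e^{-i(xu + ξv)} dx dξ` of `a : ℝ^d × ℝ^d → ℂ`. -/
def fourierPlancherel {d : ℕ} (a : EuclideanSpace ℝ (Fin d) × EuclideanSpace ℝ (Fin d) → ℂ)
    (p : EuclideanSpace ℝ (Fin d) × EuclideanSpace ℝ (Fin d)) : ℂ :=
  ((2 * Real.pi : ℝ) ^ d : ℂ)⁻¹ * ∫ q : EuclideanSpace ℝ (Fin d) × EuclideanSpace ℝ (Fin d),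
    a q * Complex.exp (-Complex.I * ((inner ℝ q.1 p.1 + inner ℝ q.2 p.2 : ℝ) : ℂ))

theorem WeylPair.integrable_weyl {d : ℕ} {X : Type*} [NormedAddCommGroup X] [NormedSpace ℂ X]
    (W : WeylPair d X) {b : EuclideanSpace ℝ (Fin d) × EuclideanSpace ℝ (Fin d) → ℂ}
    (hb : Integrable b) (f : X) : Integrable fun p => b p • W.schrodinger p f := by
  obtain ⟨M, hM⟩ := W.schrodinger_bounded
  refine (hb.norm.mul_const (M * ‖f‖)).mono'
    (hb.aestronglyMeasurable.smul (W.schrodinger_continuous f).aestronglyMeasurable)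
    (Eventually.of_forall fun p => ?_)
  rw [norm_smul]
  exact mul_le_mul_of_nonneg_left ((W.schrodinger p).le_of_opNorm_le (hM p) f) (norm_nonneg _)

open Classical in
/-- The Weyl calculus: the bounded operator
`a(A,B) f = (2π)^{-d} ∫ â(u,v) e^{i(uA + vB)} f du dv`. It is defined whenever `â` is
integrable, in particular for every Schwartz function `a` (and is `0` by convention otherwise). -/
def WeylPair.weyl {d : ℕ} {X : Type*} [NormedAddCommGroup X] [NormedSpace ℂ X]
    (W : WeylPair d X) (a : EuclideanSpace ℝ (Fin d) × EuclideanSpace ℝ (Fin d) → ℂ) :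
    X →L[ℂ] X :=
  if ha : Integrable (fourierPlancherel a) then
    LinearMap.mkContinuousOfExistsBound
      { toFun := fun f => ((2 * Real.pi : ℝ) ^ d : ℂ)⁻¹ •
          ∫ p : EuclideanSpace ℝ (Fin d) × EuclideanSpace ℝ (Fin d),
            fourierPlancherel a p • W.schrodinger p f
        map_add' := fun f g => by
          simp only [map_add, smul_add]
          rw [integral_add (W.integrable_weyl ha f) (W.integrable_weyl ha g), smul_add]
        map_smul' := fun c f => by
          simp only [map_smul, RingHom.id_apply]
          rw [smul_comm c, ← integral_smul c]
          exact congrArg _ (integral_congr_ae (Eventually.of_forall fun p =>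
            smul_comm (fourierPlancherel a p) c (W.schrodinger p f))) }
      (by
        obtain ⟨M, hM⟩ := W.schrodinger_bounded
        refine ⟨‖((2 * Real.pi : ℝ) ^ d : ℂ)⁻¹‖ * ((∫ p, ‖fourierPlancherel a p‖) * M),
          fun f => ?_⟩
        change ‖((2 * Real.pi : ℝ) ^ d : ℂ)⁻¹ • ∫ p, fourierPlancherel a p • W.schrodinger p f‖ ≤ _
        rw [norm_smul, mul_assoc]
        refine mul_le_mul_of_nonneg_left ?_ (norm_nonneg _)
        rw [mul_assoc, ← integral_mul_const]
        refine norm_integral_le_of_norm_le (ha.norm.mul_const _) (Eventually.of_forall fun p => ?_)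
        rw [norm_smul]
        exact mul_le_mul_of_nonneg_left ((W.schrodinger p).le_of_opNorm_le (hM p) f)
          (norm_nonneg _))
  else 0

/-- `λ_t = (1 - e^{-t}) / (1 + e^{-t})`. -/
def mehlerLambda (t : ℝ) : ℝ := (1 - Real.exp (-t)) / (1 + Real.exp (-t))

/-- `a_t(x,ξ) = (1 + λ_t)^d exp(-λ_t (|x|² + |ξ|²))`. -/
def mehlerSymbol (d : ℕ) (t : ℝ) (q : EuclideanSpace ℝ (Fin d) × EuclideanSpace ℝ (Fin d)) : ℂ :=
  (((1 + mehlerLambda t) ^ d * Real.exp (-mehlerLambda t * (‖q.1‖ ^ 2 + ‖q.2‖ ^ 2)) : ℝ) : ℂ)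

/-- The null space `N(T) = {f ∈ D(T) : T f = 0}` of an unbounded operator. -/
def nullSpace {X : Type*} [NormedAddCommGroup X] [NormedSpace ℂ X] (T : X →ₗ.[ℂ] X) :
    Submodule ℂ X :=
  (LinearMap.ker T.toFun).map T.domain.subtype

/-- The range `R(T) = {T f : f ∈ D(T)}` of an unbounded operator. -/
def rangeSpace {X : Type*} [NormedAddCommGroup X] [NormedSpace ℂ X] (T : X →ₗ.[ℂ] X) :
    Submodule ℂ X :=
  LinearMap.range T.toFun

end

/-!
Write `W(p) = e^{i(uA + vB)}` for `p = (u, v)`, and `σ` for the symplectic form. The commutation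
relations give the Weyl relation `W(p) W(q) = e^{½ i σ(p, q)} W(p + q)`
(`WeylPair.schrodinger_mul`).

The Fourier transform of the Mehler symbol is a Gaussian, so the operator `P t = a_t(A, B)` is a
constant multiple of the smeared operator `∫ e^{-b |p|²} W(p) dp` with `b = 1 / (4 λ_t)`.
Multiplying such an integral from the left or from the right by `W(τ e)`, for a unit vector `e`,
translates the Gaussian by `τ e` and modulates it by `e^{± ½ i τ σ(e, p)}`. Two differentiations
at `τ = 0` show how `A_j²` and `B_j²` act on the Gaussian kernel. In the sum over all directions
the terms that depend on the sign cancel, so that left and right multiplication by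
`½ (A² + B²) - ½ d` have the same effect on the kernel (`WeylPair.oscillatorKernel_eq`), and this
effect is minus the derivative of the kernel of `P t` in `t`. Hence, with `K = ½ (A² + B²) - ½ d`,
one has `d/dt P t f = -K P t f` for every `f`, and `d/dt P t f = -P t K f` for every `f` in the
domain of `K`. Only the domain of `K` enters here; mixed products such as `A_j B_k` never do.

The substitution `p = 2 √λ q` turns `P t` into an average of the operators `W(2 √λ_t q)` against a
fixed Gaussian in `q`, up to a factor. By dominated convergence `P t` is bounded, tends strongly
to the identity as `t ↓ 0` (where `λ_t → 0`), and converges strongly as `t → ∞` (where `λ_t → 1`).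

The rest is abstract (`SolvesCauchyProblem`). The derivative of `s ↦ P (t - s) P s f` is zero,
which is the semigroup law. The identity `d/dt P t f = -P t g` extends to all `(f, g)` in the
closure of the graph of `K`, hence `(P t f - f) / t → -g`; this makes `K` closable and its
negative closure a restriction of the generator. As `P s` maps into the domain of `K`, letting
`s ↓ 0` gives the reverse inclusion. Finally, the orbit `P t f` is constant for `f` in the null
space of the closure, and it is constant modulo the closed range of the closure for arbitrary `f`;
comparing the limits at `0` and at `∞` identifies the null space and the closed range in terms of
`π`.
-/

noncomputable section

/-! ### Graphs of unbounded operators -/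

section Graphs

variable {X : Type*} [NormedAddCommGroup X] [NormedSpace ℂ X]

theorem mem_graph_add_iff (S T : X →ₗ.[ℂ] X) (f g : X) :
    (f, g) ∈ (S + T).graph ↔ ∃ a b, (f, a) ∈ S.graph ∧ (f, b) ∈ T.graph ∧ g = a + b := by
  simp only [LinearPMap.mem_graph_iff]
  constructor
  · rintro ⟨⟨y, hS, hT⟩, rfl, rfl⟩
    exact ⟨S ⟨y, hS⟩, T ⟨y, hT⟩, ⟨⟨y, hS⟩, rfl, rfl⟩, ⟨⟨y, hT⟩, rfl, rfl⟩, rfl⟩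
  · rintro ⟨a, b, ⟨⟨y, hS⟩, rfl, rfl⟩, ⟨⟨z, hT⟩, hz, rfl⟩, rfl⟩
    obtain rfl : z = y := hz
    exact ⟨⟨z, hS, hT⟩, rfl, rfl⟩

theorem mem_graph_sum_iff {ι : Type*} (s : Finset ι) (T : ι → X →ₗ.[ℂ] X) (f g : X) :
    (f, g) ∈ (∑ j ∈ s, T j).graph ↔
      ∃ a : ι → X, (∀ j ∈ s, (f, a j) ∈ (T j).graph) ∧ g = ∑ j ∈ s, a j := by
  classical
  induction s using Finset.induction_on generalizing g with
  | empty =>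
    simp only [Finset.sum_empty, Finset.notMem_empty, false_implies, implies_true, true_and,
      exists_const, LinearPMap.mem_graph_iff]
    exact ⟨fun ⟨y, _, h⟩ => h.symm, fun h => ⟨⟨f, trivial⟩, rfl, h.symm⟩⟩
  | insert i s hi ih =>
    rw [Finset.sum_insert hi, mem_graph_add_iff]
    constructor
    · rintro ⟨a, b, ha, hb, rfl⟩
      obtain ⟨c, hc, rfl⟩ := (ih b).1 hb
      refine ⟨Function.update c i a, fun j hj => ?_, ?_⟩
      · rcases eq_or_ne j i with rfl | hji
        · simpa using ha
        · simpa [hji] using hc j ((Finset.mem_insert.1 hj).resolve_left hji)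
      · rw [Finset.sum_insert hi, Function.update_self]
        congr 1
        exact Finset.sum_congr rfl fun j hj => by
          rw [Function.update_of_ne (by rintro rfl; exact hi hj)]
    · rintro ⟨a, ha, rfl⟩
      exact ⟨a i, ∑ j ∈ s, a j, ha i (Finset.mem_insert_self _ _),
        (ih _).2 ⟨a, fun j hj => ha j (Finset.mem_insert_of_mem hj), rfl⟩, Finset.sum_insert hi⟩

theorem mem_graph_sqPMap_iff (T : X →ₗ.[ℂ] X) (f g : X) :
    (f, g) ∈ (sqPMap T).graph ↔ ∃ h, (f, h) ∈ T.graph ∧ (h, g) ∈ T.graph := by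
  simp only [LinearPMap.mem_graph_iff]
  constructor
  · rintro ⟨⟨_, y, hy, rfl⟩, rfl, rfl⟩
    exact ⟨T y, ⟨y, rfl, rfl⟩, ⟨⟨T y, hy⟩, rfl, rfl⟩⟩
  · rintro ⟨h, ⟨y, rfl, rfl⟩, ⟨z, hz, rfl⟩⟩
    have hz' : T y ∈ T.domain := hz ▸ z.2
    refine ⟨⟨y, y, hz', rfl⟩, rfl, ?_⟩
    obtain rfl : z = ⟨T y, hz'⟩ := Subtype.ext hz
    rfl

theorem mem_graph_neg_iff (T : X →ₗ.[ℂ] X) (f g : X) :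
    (f, g) ∈ (-T).graph ↔ (f, -g) ∈ T.graph := by
  simp only [LinearPMap.mem_graph_iff]
  constructor
  · rintro ⟨y, hy, h⟩
    exact ⟨y, hy, by rw [← h, LinearPMap.neg_apply, neg_neg]⟩
  · rintro ⟨y, hy, h⟩
    exact ⟨y, hy, by rw [LinearPMap.neg_apply, h, neg_neg]⟩

theorem mem_graph_smul_iff {c : ℂ} (hc : c ≠ 0) (T : X →ₗ.[ℂ] X) (f g : X) :
    (f, c • g) ∈ (c • T).graph ↔ (f, g) ∈ T.graph := by
  simp only [LinearPMap.mem_graph_iff]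
  constructor
  · rintro ⟨y, hy, h⟩
    exact ⟨y, hy, smul_right_injective X hc h⟩
  · rintro ⟨y, hy, h⟩
    exact ⟨y, hy, by rw [← h]; rfl⟩

theorem mem_nullSpace_iff (T : X →ₗ.[ℂ] X) (f : X) :
    f ∈ nullSpace T ↔ (f, (0 : X)) ∈ T.graph := by
  simp only [nullSpace, LinearPMap.mem_graph_iff, Submodule.mem_map, LinearMap.mem_ker]
  exact ⟨fun ⟨y, h, hy⟩ => ⟨y, hy, h⟩, fun ⟨y, hy, h⟩ => ⟨y, h, hy⟩⟩

theorem mem_rangeSpace_iff (T : X →ₗ.[ℂ] X) (g : X) :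
    g ∈ rangeSpace T ↔ ∃ f, (f, g) ∈ T.graph := by
  simp only [rangeSpace, LinearPMap.mem_graph_iff, LinearMap.mem_range]
  exact ⟨fun ⟨y, h⟩ => ⟨y, y, rfl, h⟩, fun ⟨_, y, _, h⟩ => ⟨y, h⟩⟩

theorem WeylPair.mem_graph_preL_iff {d : ℕ} (W : WeylPair d X) (f g : X) :
    (f, g) ∈ W.preL.graph ↔ ∃ a b : Fin d → X, (∀ j, (f, a j) ∈ (sqPMap (W.A j)).graph) ∧
      (∀ j, (f, b j) ∈ (sqPMap (W.B j)).graph) ∧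
      g = (1 / 2 : ℂ) • (∑ j, a j + ∑ j, b j) - (d / 2 : ℂ) • f := by
  have h2 : (1 / 2 : ℂ) ≠ 0 := by norm_num
  have hid : ∀ h : X, (f, h) ∈ (-((d / 2 : ℂ) • (LinearMap.id : X →ₗ[ℂ] X)).toPMap ⊤).graph ↔
      h = -((d / 2 : ℂ) • f) := by
    intro h
    rw [mem_graph_neg_iff, LinearPMap.mem_graph_iff]
    constructor
    · rintro ⟨y, rfl, hy⟩
      exact neg_eq_iff_eq_neg.1 hy.symm
    · rintro rfl
      exact ⟨⟨f, trivial⟩, rfl, by rw [neg_neg]; rfl⟩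
  rw [WeylPair.preL, sub_eq_add_neg, mem_graph_add_iff]
  constructor
  · rintro ⟨x, y, hx, hy, rfl⟩
    obtain ⟨z, rfl⟩ : ∃ z, x = (1 / 2 : ℂ) • z := ⟨(1 / 2 : ℂ)⁻¹ • x, by rw [smul_inv_smul₀ h2]⟩
    rw [mem_graph_smul_iff h2, mem_graph_add_iff] at hx
    obtain ⟨u, v, hu, hv, rfl⟩ := hx
    obtain ⟨a, ha, rfl⟩ := (mem_graph_sum_iff _ _ _ _).1 hu
    obtain ⟨b, hb, rfl⟩ := (mem_graph_sum_iff _ _ _ _).1 hv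
    exact ⟨a, b, fun j => ha j (Finset.mem_univ _), fun j => hb j (Finset.mem_univ _), by
      rw [(hid y).1 hy, sub_eq_add_neg]⟩
  · rintro ⟨a, b, ha, hb, rfl⟩
    refine ⟨_, _, (mem_graph_smul_iff h2 _ _ _).2 ((mem_graph_add_iff _ _ _ _).2 ⟨_, _,
      (mem_graph_sum_iff _ _ _ _).2 ⟨a, fun j _ => ha j, rfl⟩,
      (mem_graph_sum_iff _ _ _ _).2 ⟨b, fun j _ => hb j, rfl⟩, rfl⟩), (hid _).2 rfl, ?_⟩
    rw [sub_eq_add_neg]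

/-- If `i T` generates the group `U`, the graph of `T` consists of the derivatives at `0` of the
orbits of `U`. -/
theorem GeneratesBoundedGroup.mem_graph {T : X →ₗ.[ℂ] X} {U : ℝ → X →L[ℂ] X}
    (h : GeneratesBoundedGroup (Complex.I • T) U) (f g : X) :
    (f, g) ∈ T.graph ↔ HasDerivAt (fun t : ℝ => U t f) (Complex.I • g) 0 := by
  rw [← h.mem_graph_iff, mem_graph_smul_iff Complex.I_ne_zero]

end Graphs

/-! ### The Weyl commutation relations -/

section Relations

theorem List.mul_prod_map_of_mul_eq_smul {R ι : Type*} [Ring R] [Algebra ℂ R] (x : R) (y : ι → R)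
    (c : ι → ℂ) (h : ∀ j, x * y j = c j • (y j * x)) (l : List ι) :
    x * (l.map y).prod = (l.map c).prod • ((l.map y).prod * x) := by
  induction l with
  | nil => simp
  | cons j l ih =>
    simp only [List.map_cons, List.prod_cons]
    rw [← mul_assoc, h, smul_mul_assoc, mul_assoc, ih, mul_smul_comm, smul_smul, mul_assoc]

theorem List.prod_map_mul_of_mul_eq_smul {R ι : Type*} [Ring R] [Algebra ℂ R] (x : R) (y : ι → R)
    (c : ι → ℂ) (h : ∀ j, y j * x = c j • (x * y j)) (l : List ι) :
    (l.map y).prod * x = (l.map c).prod • (x * (l.map y).prod) := by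
  induction l with
  | nil => simp
  | cons j l ih =>
    simp only [List.map_cons, List.prod_cons]
    rw [mul_assoc, ih, mul_smul_comm, ← mul_assoc, h, smul_mul_assoc, smul_smul, mul_assoc,
      mul_comm (c j)]

variable {d : ℕ} {X : Type*} [NormedAddCommGroup X] [NormedSpace ℂ X]

theorem multiExp_zero {U : Fin d → ℝ → X →L[ℂ] X} (h0 : ∀ j, U j 0 = 1) :
    multiExp U 0 = 1 := by
  simp [multiExp, h0]

theorem multiExp_single {U : Fin d → ℝ → X →L[ℂ] X} (h0 : ∀ j, U j 0 = 1) (j : Fin d) (t : ℝ) :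
    multiExp U (EuclideanSpace.single j t) = U j t := by
  rw [multiExp, List.prod_map_eq_pow_single j _ fun i hi _ => by simp [hi, h0]]
  simp [List.count_eq_one_of_mem (List.nodup_finRange d) (List.mem_finRange j)]

theorem multiExp_add {U : Fin d → ℝ → X →L[ℂ] X} (hadd : ∀ j s t, U j (s + t) = U j s * U j t)
    (hcomm : ∀ j k s t, U j s * U k t = U k t * U j s) (u v : EuclideanSpace ℝ (Fin d)) :
    multiExp U (u + v) = multiExp U u * multiExp U v := by
  unfold multiExp
  induction List.finRange d with
  | nil => simp
  | cons j l ih =>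
    have h : Commute (U j (v j)) (l.map fun j => U j (u j)).prod :=
      Commute.list_prod_right _ _ fun y hy => by
        obtain ⟨k, -, rfl⟩ := List.mem_map.1 hy
        exact hcomm _ _ _ _
    simp only [List.map_cons, List.prod_cons]
    rw [ih, PiLp.add_apply, hadd, mul_assoc, mul_assoc, ← mul_assoc (U j (v j)), h.eq, mul_assoc]

/-- `e^{ivB} e^{iuA} = e^{i u v} e^{iuA} e^{ivB}`. -/
theorem WeylPair.multiExp_ccr (W : WeylPair d X) (u v : EuclideanSpace ℝ (Fin d)) :
    multiExp W.expB v * multiExp W.expA u =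
      Complex.exp (Complex.I * ((inner ℝ u v : ℝ) : ℂ)) •
        (multiExp W.expA u * multiExp W.expB v) := by
  have h1 : ∀ (j k : Fin d) (s t : ℝ), W.expB k t * W.expA j s =
      Complex.exp (if j = k then Complex.I * s * t else 0) • (W.expA j s * W.expB k t) := by
    intro j k s t
    rw [W.ccr, smul_smul, ← Complex.exp_add]
    split_ifs <;> simp
  have h2 : ∀ k t, W.expB k t * multiExp W.expA u =
      Complex.exp (Complex.I * u k * t) • (multiExp W.expA u * W.expB k t) := by
    intro k t
    rw [multiExp, List.mul_prod_map_of_mul_eq_smul _ _ _ fun j => h1 j k (u j) t,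
      ← Fin.prod_univ_def, ← Complex.exp_sum]
    simp
  rw [multiExp.eq_def W.expB, List.prod_map_mul_of_mul_eq_smul _ _ _ fun k => h2 k (v k),
    ← Fin.prod_univ_def, ← Complex.exp_sum]
  congr 2
  simp [PiLp.inner_apply, Finset.mul_sum, mul_assoc, mul_comm]

/-- The phase space `ℝ^d × ℝ^d`. -/
abbrev PhaseSpace (d : ℕ) : Type := EuclideanSpace ℝ (Fin d) × EuclideanSpace ℝ (Fin d)

/-- The standard symplectic form `σ(p, q) = p₂ q₁ - p₁ q₂` on the phase space. -/
def symplecticForm (p q : PhaseSpace d) : ℝ := inner ℝ p.2 q.1 - inner ℝ p.1 q.2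

/-- The Weyl relation `W(p) W(q) = e^{½ i σ(p, q)} W(p + q)`. -/
theorem WeylPair.schrodinger_mul (W : WeylPair d X) (p q : PhaseSpace d) :
    W.schrodinger p * W.schrodinger q =
      Complex.exp (Complex.I / 2 * (symplecticForm p q : ℝ)) • W.schrodinger (p + q) := by
  have hA := multiExp_add (fun j => (W.generates_A j).map_add) W.comm_A p.1 q.1
  have hB := multiExp_add (fun j => (W.generates_B j).map_add) W.comm_B p.2 q.2
  simp only [schrodinger, Prod.fst_add, Prod.snd_add, hA, hB]
  have h : multiExp W.expA p.1 * multiExp W.expB p.2 * (multiExp W.expA q.1 * multiExp W.expB q.2)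
      = Complex.exp (Complex.I * ((inner ℝ q.1 p.2 : ℝ) : ℂ)) •
        (multiExp W.expA p.1 * multiExp W.expA q.1 *
          (multiExp W.expB p.2 * multiExp W.expB q.2)) := by
    rw [mul_assoc, ← mul_assoc (multiExp W.expB p.2), W.multiExp_ccr]
    simp only [smul_mul_assoc, mul_smul_comm, mul_assoc]
  rw [smul_mul_smul_comm, h, smul_smul, smul_smul, ← Complex.exp_add, ← Complex.exp_add,
    ← Complex.exp_add]
  congr 2
  simp only [symplecticForm, inner_add_left, inner_add_right, real_inner_comm p.2 q.1]
  push_cast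
  rw [real_inner_comm q.1 p.2]
  ring

theorem WeylPair.schrodinger_zero (W : WeylPair d X) : W.schrodinger 0 = 1 := by
  simp [schrodinger, multiExp_zero fun j => (W.generates_A j).map_zero,
    multiExp_zero fun j => (W.generates_B j).map_zero]

theorem WeylPair.schrodinger_single_left (W : WeylPair d X) (j : Fin d) (t : ℝ) :
    W.schrodinger (t • (EuclideanSpace.single j (1 : ℝ), 0)) = W.expA j t := by
  have h : t • EuclideanSpace.single j (1 : ℝ) = EuclideanSpace.single j t := by
    ext i; by_cases hi : i = j <;> simp [hi]
  simp [schrodinger, multiExp_zero fun j => (W.generates_B j).map_zero, h,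
    multiExp_single fun j => (W.generates_A j).map_zero]

theorem WeylPair.schrodinger_single_right (W : WeylPair d X) (j : Fin d) (t : ℝ) :
    W.schrodinger (t • (0, EuclideanSpace.single j (1 : ℝ))) = W.expB j t := by
  have h : t • EuclideanSpace.single j (1 : ℝ) = EuclideanSpace.single j t := by
    ext i; by_cases hi : i = j <;> simp [hi]
  simp [schrodinger, multiExp_zero fun j => (W.generates_A j).map_zero, h,
    multiExp_single fun j => (W.generates_B j).map_zero]

end Relations

/-! ### Gaussian kernels on the phase space -/

section Gaussian

variable {d : ℕ}

instance phaseSpace_isAddHaarMeasure :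
    (volume : Measure (PhaseSpace d)).IsAddHaarMeasure :=
  Measure.prod.instIsAddHaarMeasure _ _

/-- The Euclidean inner product `p₁ q₁ + p₂ q₂` on the phase space (whose norm as a product
of normed spaces is not the Euclidean one). -/
def phaseInner (p q : PhaseSpace d) : ℝ := inner ℝ p.1 q.1 + inner ℝ p.2 q.2

/-- The square `|p₁|² + |p₂|²` of the Euclidean norm on the phase space. -/
def phaseNormSq (p : PhaseSpace d) : ℝ := ‖p.1‖ ^ 2 + ‖p.2‖ ^ 2

/-- The Gaussian `e^{-b (|p₁|² + |p₂|²)}`. -/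
def phaseGaussian (b : ℝ) (p : PhaseSpace d) : ℂ := (Real.exp (-b * phaseNormSq p) : ℝ)

theorem phaseNormSq_nonneg (p : PhaseSpace d) : 0 ≤ phaseNormSq p := by
  unfold phaseNormSq; positivity

@[fun_prop]
theorem continuous_phaseNormSq : Continuous (phaseNormSq (d := d)) := by
  unfold phaseNormSq; fun_prop

@[fun_prop]
theorem continuous_phaseGaussian (b : ℝ) : Continuous (phaseGaussian (d := d) b) := by
  unfold phaseGaussian; fun_prop

@[fun_prop]
theorem continuous_phaseInner (e : PhaseSpace d) : Continuous (phaseInner e) := by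
  unfold phaseInner; fun_prop

@[fun_prop]
theorem continuous_symplecticForm (e : PhaseSpace d) : Continuous (symplecticForm e) := by
  unfold symplecticForm; fun_prop

theorem norm_phaseGaussian (b : ℝ) (p : PhaseSpace d) :
    ‖phaseGaussian b p‖ = Real.exp (-b * phaseNormSq p) := by
  rw [phaseGaussian, Complex.norm_real, Real.norm_of_nonneg (Real.exp_pos _).le]

theorem phaseGaussian_eq_mul (b : ℝ) (p : PhaseSpace d) : phaseGaussian b p =
    Complex.exp (-b * ‖p.1‖ ^ 2) * Complex.exp (-b * ‖p.2‖ ^ 2) := by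
  rw [phaseGaussian, phaseNormSq, ← Complex.exp_add]
  push_cast
  ring_nf

theorem integrable_phaseGaussian {b : ℝ} (hb : 0 < b) :
    Integrable (phaseGaussian (d := d) b) := by
  have h : Integrable fun v : EuclideanSpace ℝ (Fin d) => Complex.exp (-b * ‖v‖ ^ 2) := by
    simpa using GaussianFourier.integrable_cexp_neg_mul_sq_norm_add (b := (b : ℂ))
      (V := EuclideanSpace ℝ (Fin d)) (by simpa using hb) 0 0
  exact (h.mul_prod h).congr (Eventually.of_forall fun p => (phaseGaussian_eq_mul b p).symm)

theorem integrable_exp_neg_phaseNormSq {b : ℝ} (hb : 0 < b) :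
    Integrable fun p : PhaseSpace d => Real.exp (-b * phaseNormSq p) := by
  simpa only [norm_phaseGaussian] using (integrable_phaseGaussian hb).norm

/-- A Gaussian times a polynomial and an exponential of a function of linear growth is
integrable. -/
theorem integrable_gaussian_mul_pow_mul_exp {b : ℝ} (hb : 0 < b) {m : PhaseSpace d → ℂ}
    (hm : Continuous m) {C : ℝ} (hC : ∀ p, ‖m p‖ ^ 2 ≤ C * phaseNormSq p) (n : ℕ) {r : ℝ} :
    Integrable fun p : PhaseSpace d =>
      Real.exp (-b * phaseNormSq p) * ‖m p‖ ^ n * Real.exp (r * ‖m p‖) := by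
  set D : ℝ := |C| + 1 with hD
  have hDpos : 0 < D := by positivity
  have hmD : ∀ p, ‖m p‖ ^ 2 ≤ D * phaseNormSq p := fun p => (hC p).trans
    (mul_le_mul_of_nonneg_right ((le_abs_self C).trans (by rw [hD]; linarith))
      (phaseNormSq_nonneg p))
  refine ((integrable_exp_neg_phaseNormSq (half_pos hb)).const_mul
    (n.factorial * Real.exp ((r + 1) ^ 2 * D / (2 * b)))).mono'
    (by fun_prop) (Eventually.of_forall fun p => ?_)
  have hx := norm_nonneg (m p)
  rw [Real.norm_of_nonneg (by positivity)]
  have h1 : ‖m p‖ ^ n ≤ n.factorial * Real.exp ‖m p‖ := by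
    have := Real.pow_div_factorial_le_exp _ hx n
    rwa [div_le_iff₀' (by positivity)] at this
  -- the arithmetic-geometric mean inequality absorbs the linear growth into half of the Gaussian
  have h2 : (r + 1) * ‖m p‖ ≤ b / 2 * phaseNormSq p + (r + 1) ^ 2 * D / (2 * b) := by
    have h3 : (r + 1) * ‖m p‖ ≤ b / (2 * D) * ‖m p‖ ^ 2 + (r + 1) ^ 2 * D / (2 * b) := by
      have h4 : b / (2 * D) * ‖m p‖ ^ 2 + (r + 1) ^ 2 * D / (2 * b) - (r + 1) * ‖m p‖ =
          (b * ‖m p‖ - (r + 1) * D) ^ 2 / (2 * b * D) := by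
        field_simp
        ring
      have h5 : 0 ≤ (b * ‖m p‖ - (r + 1) * D) ^ 2 / (2 * b * D) := by positivity
      linarith
    have h6 : b / (2 * D) * ‖m p‖ ^ 2 ≤ b / 2 * phaseNormSq p := by
      calc b / (2 * D) * ‖m p‖ ^ 2 ≤ b / (2 * D) * (D * phaseNormSq p) :=
            mul_le_mul_of_nonneg_left (hmD p) (by positivity)
        _ = b / 2 * phaseNormSq p := by field_simp
    linarith
  calc Real.exp (-b * phaseNormSq p) * ‖m p‖ ^ n * Real.exp (r * ‖m p‖)
      ≤ Real.exp (-b * phaseNormSq p) * (n.factorial * Real.exp ‖m p‖) *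
          Real.exp (r * ‖m p‖) := by gcongr
    _ = n.factorial * Real.exp (-b * phaseNormSq p + (r + 1) * ‖m p‖) := by
        rw [add_mul, one_mul, Real.exp_add, Real.exp_add]; ring
    _ ≤ n.factorial * Real.exp (-(b / 2) * phaseNormSq p + (r + 1) ^ 2 * D / (2 * b)) := by
        exact mul_le_mul_of_nonneg_left (Real.exp_le_exp.2 (by linarith)) (by positivity)
    _ = _ := by rw [Real.exp_add]; ring

theorem integrable_gaussian_mul_phaseNormSq {b : ℝ} (hb : 0 < b) :
    Integrable fun p : PhaseSpace d => Real.exp (-b * phaseNormSq p) * phaseNormSq p := by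
  refine ((integrable_exp_neg_phaseNormSq (half_pos hb)).const_mul (2 / b)).mono'
    (by fun_prop) (Eventually.of_forall fun p => ?_)
  have hx := phaseNormSq_nonneg p
  rw [Real.norm_of_nonneg (by positivity)]
  have h1 : phaseNormSq p ≤ 2 / b * Real.exp (b / 2 * phaseNormSq p) := by
    have h2 := Real.add_one_le_exp (b / 2 * phaseNormSq p)
    calc phaseNormSq p = 2 / b * (b / 2 * phaseNormSq p) := by field_simp
      _ ≤ _ := by gcongr; linarith
  calc Real.exp (-b * phaseNormSq p) * phaseNormSq p
      ≤ Real.exp (-b * phaseNormSq p) * (2 / b * Real.exp (b / 2 * phaseNormSq p)) := by gcongr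
    _ = 2 / b * Real.exp (-b * phaseNormSq p + b / 2 * phaseNormSq p) := by
        rw [Real.exp_add]; ring
    _ = _ := by ring_nf

/-- The logarithmic derivative at `τ = 0` of the translated and modulated Gaussian
`e^{-b |p - τ e|²} e^{i τ s σ(e, p)}`. -/
def phaseMultiplier (b s : ℝ) (e p : PhaseSpace d) : ℂ :=
  2 * b * (phaseInner e p : ℝ) + Complex.I * s * (symplecticForm e p : ℝ)

@[fun_prop]
theorem continuous_phaseMultiplier (b s : ℝ) (e : PhaseSpace d) :
    Continuous (phaseMultiplier b s e) := by
  unfold phaseMultiplier; fun_prop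

theorem exists_norm_phaseMultiplier_sq_le (b s : ℝ) (e : PhaseSpace d) :
    ∃ C : ℝ, ∀ p, ‖phaseMultiplier b s e p‖ ^ 2 ≤ C * phaseNormSq p := by
  refine ⟨2 * ((2 * |b| + |s|) * (‖e.1‖ + ‖e.2‖)) ^ 2, fun p => ?_⟩
  have h1 : |phaseInner e p| ≤ (‖e.1‖ + ‖e.2‖) * (‖p.1‖ + ‖p.2‖) := by
    have h2 := abs_real_inner_le_norm e.1 p.1
    have h3 := abs_real_inner_le_norm e.2 p.2
    refine (abs_add_le _ _).trans ?_
    nlinarith [norm_nonneg e.1, norm_nonneg e.2, norm_nonneg p.1, norm_nonneg p.2,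
      mul_nonneg (norm_nonneg e.1) (norm_nonneg p.2),
      mul_nonneg (norm_nonneg e.2) (norm_nonneg p.1)]
  have h4 : |symplecticForm e p| ≤ (‖e.1‖ + ‖e.2‖) * (‖p.1‖ + ‖p.2‖) := by
    have h2 := abs_real_inner_le_norm e.2 p.1
    have h3 := abs_real_inner_le_norm e.1 p.2
    refine (abs_sub _ _).trans ?_
    nlinarith [norm_nonneg e.1, norm_nonneg e.2, norm_nonneg p.1, norm_nonneg p.2,
      mul_nonneg (norm_nonneg e.1) (norm_nonneg p.1),
      mul_nonneg (norm_nonneg e.2) (norm_nonneg p.2)]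
  have h5 : ‖phaseMultiplier b s e p‖ ≤
      (2 * |b| + |s|) * (‖e.1‖ + ‖e.2‖) * (‖p.1‖ + ‖p.2‖) := by
    refine (norm_add_le _ _).trans ?_
    simp only [norm_mul, Complex.norm_real, Complex.norm_I, Complex.norm_ofNat, one_mul,
      Real.norm_eq_abs]
    have := mul_le_mul_of_nonneg_left h1 (by positivity : 0 ≤ 2 * |b|)
    have := mul_le_mul_of_nonneg_left h4 (abs_nonneg s)
    linarith
  have h6 : (‖p.1‖ + ‖p.2‖) ^ 2 ≤ 2 * phaseNormSq p := by
    unfold phaseNormSq; nlinarith [sq_nonneg (‖p.1‖ - ‖p.2‖)]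
  calc ‖phaseMultiplier b s e p‖ ^ 2
      ≤ ((2 * |b| + |s|) * (‖e.1‖ + ‖e.2‖) * (‖p.1‖ + ‖p.2‖)) ^ 2 := by gcongr
    _ = ((2 * |b| + |s|) * (‖e.1‖ + ‖e.2‖)) ^ 2 * (‖p.1‖ + ‖p.2‖) ^ 2 := by ring
    _ ≤ ((2 * |b| + |s|) * (‖e.1‖ + ‖e.2‖)) ^ 2 * (2 * phaseNormSq p) := by gcongr
    _ = _ := by ring

theorem phaseNormSq_sub_smul (e p : PhaseSpace d) (τ : ℝ) :
    phaseNormSq (p - τ • e) = phaseNormSq p - 2 * τ * phaseInner e p + τ ^ 2 * phaseNormSq e := by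
  simp only [phaseNormSq, phaseInner, Prod.fst_sub, Prod.snd_sub, Prod.smul_fst, Prod.smul_snd,
    norm_sub_sq_real, inner_smul_right, norm_smul, mul_pow, Real.norm_eq_abs, sq_abs,
    real_inner_comm e.1 p.1, real_inner_comm e.2 p.2]
  ring

theorem phaseInner_sub_smul (e p : PhaseSpace d) (τ : ℝ) :
    phaseInner e (p - τ • e) = phaseInner e p - τ * phaseNormSq e := by
  simp only [phaseNormSq, phaseInner, Prod.fst_sub, Prod.snd_sub, Prod.smul_fst, Prod.smul_snd,
    inner_sub_right, inner_smul_right, real_inner_self_eq_norm_sq]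
  ring

theorem symplecticForm_sub_smul (e p : PhaseSpace d) (τ : ℝ) :
    symplecticForm e (p - τ • e) = symplecticForm e p := by
  simp only [symplecticForm, Prod.fst_sub, Prod.snd_sub, Prod.smul_fst, Prod.smul_snd,
    inner_sub_right, inner_smul_right, real_inner_comm e.1 e.2]
  ring

theorem phaseMultiplier_sub_smul (b s : ℝ) (e p : PhaseSpace d) (τ : ℝ) :
    phaseMultiplier b s e (p - τ • e) = phaseMultiplier b s e p - 2 * b * τ * phaseNormSq e := by
  simp only [phaseMultiplier, phaseInner_sub_smul, symplecticForm_sub_smul]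
  push_cast
  ring

theorem phaseGaussian_sub_smul_mul_exp (b s : ℝ) (e p : PhaseSpace d) (τ : ℝ) :
    phaseGaussian b (p - τ • e) * Complex.exp (Complex.I * s * τ * symplecticForm e p) =
      Complex.exp (-b * τ ^ 2 * phaseNormSq e) *
        (phaseGaussian b p * Complex.exp (τ * phaseMultiplier b s e p)) := by
  simp only [phaseGaussian, phaseMultiplier, phaseNormSq_sub_smul, Complex.ofReal_exp,
    ← Complex.exp_add]
  congr 1
  push_cast
  ring

end Gaussian

/-! ### Smeared Weyl operators and their derivatives -/

namespace WeylPair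

variable {d : ℕ} {X : Type*} [NormedAddCommGroup X] [NormedSpace ℂ X] (W : WeylPair d X)

/-- The smeared Weyl operator `f ↦ ∫ κ(p) W(p) f dp`. -/
def smear (κ : PhaseSpace d → ℂ) (f : X) : X := ∫ p, κ p • W.schrodinger p f

/-- For an integrable kernel the smeared Weyl operator is a bounded linear operator. -/
theorem exists_clm_eq_smear {κ : PhaseSpace d → ℂ} (hκ : Integrable κ) :
    ∃ T : X →L[ℂ] X, ∀ f, T f = W.smear κ f := by
  obtain ⟨M, hM⟩ := W.schrodinger_bounded
  refine ⟨LinearMap.mkContinuous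
    { toFun := W.smear κ
      map_add' := fun f g => ?_
      map_smul' := fun c f => ?_ } ((∫ p, ‖κ p‖) * M) fun f => ?_, fun f => rfl⟩
  · simp only [smear, map_add, smul_add]
    exact integral_add (W.integrable_weyl hκ f) (W.integrable_weyl hκ g)
  · simp only [smear, map_smul, RingHom.id_apply]
    rw [← integral_smul c]
    exact integral_congr_ae (Eventually.of_forall fun p => smul_comm _ _ _)
  · change ‖∫ p, κ p • W.schrodinger p f‖ ≤ _
    rw [mul_assoc, ← integral_mul_const]
    refine norm_integral_le_of_norm_le (hκ.norm.mul_const _) (Eventually.of_forall fun p => ?_)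
    rw [norm_smul]
    exact mul_le_mul_of_nonneg_left ((W.schrodinger p).le_of_opNorm_le (hM p) f) (norm_nonneg _)

/-- Differentiation under the integral sign for a kernel `κ e^{τ m}`. -/
theorem hasDerivAt_smear_exp {κ m : PhaseSpace d → ℂ} (hκ : Continuous κ) (hm : Continuous m)
    (hκi : Integrable κ) {r : ℝ} (hr : 0 < r)
    (hi : Integrable fun p => ‖κ p‖ * ‖m p‖ * Real.exp (r * ‖m p‖)) (f : X) :
    HasDerivAt (fun τ : ℝ => W.smear (fun p => κ p * Complex.exp (τ * m p)) f)
      (W.smear (fun p => κ p * m p) f) 0 := by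
  obtain ⟨M, hM⟩ := W.schrodinger_bounded
  have hW := W.schrodinger_continuous f
  have key := (hasDerivAt_integral_of_dominated_loc_of_deriv_le (𝕜 := ℝ) (μ := volume)
    (x₀ := (0 : ℝ)) (s := Metric.ball 0 r)
    (F := fun τ p => (κ p * Complex.exp (τ * m p)) • W.schrodinger p f)
    (F' := fun τ p => (κ p * (Complex.exp (τ * m p) * m p)) • W.schrodinger p f)
    (bound := fun p => ‖κ p‖ * ‖m p‖ * Real.exp (r * ‖m p‖) * (M * ‖f‖))
    (Metric.ball_mem_nhds _ hr)
    (Eventually.of_forall fun τ => by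
      exact Continuous.aestronglyMeasurable (by fun_prop))
    (by simpa using W.integrable_weyl hκi f)
    (Continuous.aestronglyMeasurable (by fun_prop))
    (Eventually.of_forall fun p τ hτ => ?_) (hi.mul_const _)
    (Eventually.of_forall fun p τ hτ => ?_)).2
  · simpa [smear] using key
  · rw [norm_smul, norm_mul, norm_mul]
    have h1 : ‖Complex.exp (τ * m p)‖ ≤ Real.exp (r * ‖m p‖) := by
      refine (Complex.norm_exp_le_exp_norm _).trans (Real.exp_le_exp.2 ?_)
      rw [norm_mul, Complex.norm_real]
      exact mul_le_mul_of_nonneg_right (by simpa using (Metric.mem_ball.1 hτ).le) (norm_nonneg _)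
    have h2 := (W.schrodinger p).le_of_opNorm_le (hM p) f
    calc ‖κ p‖ * (‖Complex.exp (τ * m p)‖ * ‖m p‖) * ‖W.schrodinger p f‖
        ≤ ‖κ p‖ * (Real.exp (r * ‖m p‖) * ‖m p‖) * (M * ‖f‖) := by gcongr
      _ = _ := by ring
  · have h1 : HasDerivAt (fun τ : ℝ => (τ : ℂ) * m p) (1 * m p) τ :=
      (Complex.ofRealCLM.hasDerivAt (x := τ)).mul_const (m p)
    rw [one_mul] at h1
    exact (h1.cexp.const_mul (κ p)).smul_const _

/-- A translation of the Weyl operators under the integral is moved to the kernel; the modulation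
by `σ(e, ·)` is invariant under translation along `e`. -/
theorem integral_translate (κ : PhaseSpace d → ℂ) (s : ℝ) (e : PhaseSpace d) (τ : ℝ) (f : X) :
    ∫ p, (κ p * Complex.exp (Complex.I * s * τ * symplecticForm e p)) •
        W.schrodinger (p + τ • e) f =
      W.smear (fun p => κ (p - τ • e) *
        Complex.exp (Complex.I * s * τ * symplecticForm e p)) f := by
  rw [← integral_sub_right_eq_self _ (τ • e)]
  simp only [symplecticForm_sub_smul, sub_add_cancel, smear]

/-- Left multiplication of a smeared operator by `W(τ e)` translates and modulates its kernel. -/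
theorem schrodinger_smear [CompleteSpace X] {κ : PhaseSpace d → ℂ} (hκ : Integrable κ)
    (e : PhaseSpace d) (τ : ℝ) (f : X) :
    W.schrodinger (τ • e) (W.smear κ f) = W.smear (fun p => κ (p - τ • e) *
        Complex.exp (Complex.I * (1 / 2 : ℝ) * τ * symplecticForm e p)) f := by
  rw [← integral_translate, smear,
    ← ContinuousLinearMap.integral_comp_comm _ (W.integrable_weyl hκ f)]
  refine integral_congr_ae (Eventually.of_forall fun p => ?_)
  have h := congrArg (fun T : X →L[ℂ] X => T f) (W.schrodinger_mul (τ • e) p)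
  simp only [mul_apply_eq_comp, smul_apply] at h
  simp only [map_smul, h, smul_smul, add_comm (τ • e) p]
  congr 3
  simp only [symplecticForm, Prod.smul_fst, Prod.smul_snd, inner_smul_left]
  push_cast
  simp
  ring

/-- Right multiplication of a smeared operator by `W(τ e)` differs from left multiplication by the
sign of the modulation. -/
theorem smear_schrodinger {κ : PhaseSpace d → ℂ} (e : PhaseSpace d) (τ : ℝ) (f : X) :
    W.smear κ (W.schrodinger (τ • e) f) = W.smear (fun p => κ (p - τ • e) *
        Complex.exp (Complex.I * (-(1 / 2) : ℝ) * τ * symplecticForm e p)) f := by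
  rw [← integral_translate, smear]
  refine integral_congr_ae (Eventually.of_forall fun p => ?_)
  have h := congrArg (fun T : X →L[ℂ] X => T f) (W.schrodinger_mul p (τ • e))
  simp only [mul_apply_eq_comp, smul_apply] at h
  simp only [h, smul_smul]
  congr 3
  simp only [symplecticForm, Prod.smul_fst, Prod.smul_snd, inner_smul_right,
    real_inner_comm e.1 p.2, real_inner_comm e.2 p.1]
  push_cast
  ring

theorem smear_const_mul (c : ℂ) (κ : PhaseSpace d → ℂ) (f : X) :
    W.smear (fun p => c * κ p) f = c • W.smear κ f := by
  simp only [smear, mul_smul]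
  exact integral_smul c _

theorem smear_sub {κ κ' : PhaseSpace d → ℂ} (hκ : Integrable κ) (hκ' : Integrable κ') (f : X) :
    W.smear (fun p => κ p - κ' p) f = W.smear κ f - W.smear κ' f := by
  simp only [smear, sub_smul]
  exact integral_sub (W.integrable_weyl hκ f) (W.integrable_weyl hκ' f)

theorem integrable_gaussian_mul_multiplier_pow_mul_exp {b : ℝ} (hb : 0 < b) (s : ℝ)
    (e : PhaseSpace d) (n : ℕ) (τ : ℝ) : Integrable fun p => phaseGaussian b p *
      phaseMultiplier b s e p ^ n * Complex.exp (τ * phaseMultiplier b s e p) := by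
  obtain ⟨C, hC⟩ := exists_norm_phaseMultiplier_sq_le b s e
  refine (integrable_gaussian_mul_pow_mul_exp hb (continuous_phaseMultiplier b s e) hC n
    (r := |τ|)).mono' (by fun_prop) (Eventually.of_forall fun p => ?_)
  rw [norm_mul, norm_mul, norm_pow, norm_phaseGaussian]
  gcongr
  exact (Complex.norm_exp_le_exp_norm _).trans (by simp)

theorem integrable_gaussian_mul_multiplier_pow {b : ℝ} (hb : 0 < b) (s : ℝ) (e : PhaseSpace d)
    (n : ℕ) : Integrable fun p => phaseGaussian b p * phaseMultiplier b s e p ^ n := by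
  simpa using integrable_gaussian_mul_multiplier_pow_mul_exp hb s e n 0

theorem hasDerivAt_smear_gaussian_pow {b : ℝ} (hb : 0 < b) (s : ℝ) (e : PhaseSpace d)
    (n : ℕ) (f : X) : HasDerivAt (fun τ : ℝ => W.smear (fun p =>
        phaseGaussian b p * phaseMultiplier b s e p ^ n *
          Complex.exp (τ * phaseMultiplier b s e p)) f)
      (W.smear (fun p => phaseGaussian b p * phaseMultiplier b s e p ^ (n + 1)) f) 0 := by
  obtain ⟨C, hC⟩ := exists_norm_phaseMultiplier_sq_le b s e
  have hi := integrable_gaussian_mul_pow_mul_exp hb (continuous_phaseMultiplier b s e) hC (n + 1)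
    (r := 1)
  have h := W.hasDerivAt_smear_exp
    (κ := fun p => phaseGaussian b p * phaseMultiplier b s e p ^ n) (by fun_prop)
    (continuous_phaseMultiplier b s e) (integrable_gaussian_mul_multiplier_pow hb s e n)
    one_pos (by simpa [norm_phaseGaussian, pow_succ, mul_assoc] using hi) f
  simpa only [pow_succ, mul_assoc] using h

theorem hasDerivAt_cexp_neg_mul_sq (b c : ℝ) :
    HasDerivAt (fun τ : ℝ => Complex.exp (-b * τ ^ 2 * c)) 0 0 := by
  have h : HasDerivAt (fun τ : ℝ => ((-b * τ ^ 2 * c : ℝ) : ℂ)) 0 0 := by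
    have h3 : HasDerivAt (fun τ : ℝ => -b * τ ^ 2 * c) 0 0 := by
      simpa using (((hasDerivAt_id (0 : ℝ)).pow 2).const_mul (-b)).mul_const c
    simpa using h3.ofReal_comp
  simpa using h.cexp

theorem hasDerivAt_smear_translate_gaussian {b : ℝ} (hb : 0 < b) (s : ℝ) (e : PhaseSpace d)
    (f : X) : HasDerivAt (fun τ : ℝ => W.smear (fun p => phaseGaussian b (p - τ • e) *
        Complex.exp (Complex.I * s * τ * symplecticForm e p)) f)
      (W.smear (fun p => phaseGaussian b p * phaseMultiplier b s e p) f) 0 := by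
  simp only [phaseGaussian_sub_smul_mul_exp, smear_const_mul]
  have h0 := W.hasDerivAt_smear_gaussian_pow hb s e 0 f
  have h1 := hasDerivAt_cexp_neg_mul_sq b (phaseNormSq e)
  simp only [pow_zero, mul_one, zero_add, pow_one] at h0
  exact (h1.smul h0).congr_deriv (by simp)

theorem hasDerivAt_smear_translate_multiplier {b : ℝ} (hb : 0 < b) (s : ℝ) (e : PhaseSpace d)
    (f : X) : HasDerivAt (fun τ : ℝ => W.smear (fun p =>
        phaseGaussian b (p - τ • e) * phaseMultiplier b s e (p - τ • e) *
          Complex.exp (Complex.I * s * τ * symplecticForm e p)) f)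
      (W.smear (fun p => phaseGaussian b p *
        (phaseMultiplier b s e p ^ 2 - 2 * b * phaseNormSq e)) f) 0 := by
  have hsplit : ∀ τ : ℝ, W.smear (fun p =>
        phaseGaussian b (p - τ • e) * phaseMultiplier b s e (p - τ • e) *
          Complex.exp (Complex.I * s * τ * symplecticForm e p)) f =
      Complex.exp (-b * τ ^ 2 * phaseNormSq e) •
        (W.smear (fun p => phaseGaussian b p * phaseMultiplier b s e p ^ 1 *
            Complex.exp (τ * phaseMultiplier b s e p)) f -
          (τ * (2 * b * phaseNormSq e) : ℂ) • W.smear (fun p => phaseGaussian b p *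
            phaseMultiplier b s e p ^ 0 * Complex.exp (τ * phaseMultiplier b s e p)) f) := by
    intro τ
    rw [← smear_const_mul, ← smear_sub W
      (integrable_gaussian_mul_multiplier_pow_mul_exp hb s e 1 τ)
      ((integrable_gaussian_mul_multiplier_pow_mul_exp hb s e 0 τ).const_mul _),
      ← smear_const_mul]
    congr 1
    ext p
    rw [mul_right_comm, phaseGaussian_sub_smul_mul_exp, phaseMultiplier_sub_smul]
    ring
  simp only [hsplit]
  have h0 := W.hasDerivAt_smear_gaussian_pow hb s e 0 f
  have h1 := W.hasDerivAt_smear_gaussian_pow hb s e 1 f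
  have h2 := hasDerivAt_cexp_neg_mul_sq b (phaseNormSq e)
  have h3 : HasDerivAt (fun τ : ℝ => (τ * (2 * b * phaseNormSq e) : ℂ))
      (1 * (2 * b * phaseNormSq e)) 0 :=
    (Complex.ofRealCLM.hasDerivAt (x := (0 : ℝ))).mul_const _
  refine (h2.smul (h1.sub (h3.smul h0))).congr_deriv ?_
  simp only [Complex.ofReal_zero, zero_mul, Complex.exp_zero, mul_one, one_mul, zero_smul,
    pow_zero, zero_add, add_zero, one_smul, mul_zero, ne_eq, OfNat.ofNat_ne_zero,
    not_false_eq_true, zero_pow, zero_mul]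
  rw [← smear_const_mul, ← smear_sub W (integrable_gaussian_mul_multiplier_pow hb s e _)
    ((integrable_phaseGaussian hb).const_mul _)]
  congr 1
  ext p
  ring

end WeylPair

/-! ### The harmonic oscillator on smeared vectors -/

namespace WeylPair

variable {d : ℕ} {X : Type*} [NormedAddCommGroup X] [NormedSpace ℂ X] (W : WeylPair d X)

theorem smear_finset_sum {ι : Type*} (s : Finset ι) {κ : ι → PhaseSpace d → ℂ}
    (hκ : ∀ i ∈ s, Integrable (κ i)) (f : X) :
    W.smear (fun p => ∑ i ∈ s, κ i p) f = ∑ i ∈ s, W.smear (κ i) f := by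
  simp only [smear, Finset.sum_smul]
  exact integral_finsetSum _ fun i hi => W.integrable_weyl (hκ i hi) f

theorem smear_add {κ κ' : PhaseSpace d → ℂ} (hκ : Integrable κ) (hκ' : Integrable κ') (f : X) :
    W.smear (fun p => κ p + κ' p) f = W.smear κ f + W.smear κ' f := by
  simp only [smear, add_smul]
  exact integral_add (W.integrable_weyl hκ f) (W.integrable_weyl hκ' f)

/-- The kernel `e^{-b |p|²} (m² - 2 b)` that appears when the square of a generator of a group
`W(τ e)` is applied to the Gaussian `e^{-b |p|²}`; here `m` is the multiplier of the direction
`e`, a unit vector. The sign of `s = ±½` tells left from right multiplication. -/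
def squareKernel (b s : ℝ) (e p : PhaseSpace d) : ℂ :=
  phaseGaussian b p * (phaseMultiplier b s e p ^ 2 - 2 * b)

theorem integrable_squareKernel {b : ℝ} (hb : 0 < b) (s : ℝ) (e : PhaseSpace d) :
    Integrable (squareKernel b s e) := by
  have h := (integrable_gaussian_mul_multiplier_pow hb s e 2).sub
    ((integrable_phaseGaussian hb).mul_const (2 * b : ℂ))
  exact h.congr (Eventually.of_forall fun p => (mul_sub _ _ _).symm)

/-- If `i T` generates the group `W(τ e)`, the operator `T²` is defined on vectors smeared with
a Gaussian. -/
theorem smear_mem_graph_sqPMap [CompleteSpace X] {T : X →ₗ.[ℂ] X} {e : PhaseSpace d}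
    (hT : ∀ f g, (f, g) ∈ T.graph ↔
      HasDerivAt (fun τ : ℝ => W.schrodinger (τ • e) f) (Complex.I • g) 0)
    (he : phaseNormSq e = 1) {b : ℝ} (hb : 0 < b) (f : X) :
    (W.smear (phaseGaussian b) f, -W.smear (squareKernel b (1 / 2) e) f) ∈
      (sqPMap T).graph := by
  set g := W.smear (fun p => phaseGaussian b p * phaseMultiplier b (1 / 2) e p) f with hg
  have h1 : HasDerivAt (fun τ : ℝ => W.schrodinger (τ • e) (W.smear (phaseGaussian b) f)) g 0 := by
    simp only [W.schrodinger_smear (integrable_phaseGaussian hb)]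
    exact W.hasDerivAt_smear_translate_gaussian hb _ e f
  have h2 : HasDerivAt (fun τ : ℝ => W.schrodinger (τ • e) g)
      (W.smear (squareKernel b (1 / 2) e) f) 0 := by
    have hi := integrable_gaussian_mul_multiplier_pow hb (1 / 2) e 1
    simp only [pow_one] at hi
    simp only [hg, W.schrodinger_smear hi]
    refine (W.hasDerivAt_smear_translate_multiplier hb (1 / 2) e f).congr_deriv ?_
    simp only [he, Complex.ofReal_one, mul_one]
    rfl
  refine (mem_graph_sqPMap_iff _ _ _).2 ⟨-Complex.I • g, (hT _ _).2 ?_, (hT _ _).2 ?_⟩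
  · simpa [smul_smul] using h1
  · simp only [map_smul]
    exact (h2.const_smul (-Complex.I)).congr_deriv (by simp)

/-- If `i T` generates the group `W(τ e)`, smearing a vector of the form `T² f` amounts to
smearing `f` with another kernel. -/
theorem smear_of_mem_graph_sqPMap {T : X →ₗ.[ℂ] X} {e : PhaseSpace d}
    (hT : ∀ f g, (f, g) ∈ T.graph ↔
      HasDerivAt (fun τ : ℝ => W.schrodinger (τ • e) f) (Complex.I • g) 0)
    (he : phaseNormSq e = 1) {b : ℝ} (hb : 0 < b) {f g : X} (hfg : (f, g) ∈ (sqPMap T).graph) :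
    W.smear (phaseGaussian b) g = -W.smear (squareKernel b (-(1 / 2)) e) f := by
  obtain ⟨h, hfh, hhg⟩ := (mem_graph_sqPMap_iff _ _ _).1 hfg
  rw [hT] at hfh hhg
  have hi := integrable_gaussian_mul_multiplier_pow hb (-(1 / 2)) e 1
  simp only [pow_one] at hi
  -- `T` is moved through the two smeared operators one factor at a time
  obtain ⟨S, hS⟩ := W.exists_clm_eq_smear (integrable_phaseGaussian hb)
  obtain ⟨R, hR⟩ := W.exists_clm_eq_smear hi
  have hderiv : ∀ (Q : X →L[ℂ] X) {x y : X},
      HasDerivAt (fun τ : ℝ => W.schrodinger (τ • e) x) y 0 →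
      HasDerivAt (fun τ : ℝ => Q (W.schrodinger (τ • e) x)) (Q y) 0 := fun Q x y hxy =>
    (Q.restrictScalars ℝ).hasFDerivAt.comp_hasDerivAt (0 : ℝ) hxy
  have h1 := hderiv S hhg
  simp only [hS, W.smear_schrodinger] at h1
  have e1 := h1.unique (W.hasDerivAt_smear_translate_gaussian hb _ e h)
  have h2 := hderiv R hfh
  simp only [hR, W.smear_schrodinger] at h2
  have e2 := h2.unique (W.hasDerivAt_smear_translate_multiplier hb _ e f)
  rw [← hS, map_smul, hS] at e1
  rw [← hR, map_smul, hR] at e2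
  rw [← e1, smul_smul, Complex.I_mul_I, he] at e2
  simp only [Complex.ofReal_one, mul_one, neg_smul, one_smul] at e2
  exact neg_eq_iff_eq_neg.1 e2

/-- The unit vector of the phase space in the direction of the `j`-th position. -/
def positionDir (j : Fin d) : PhaseSpace d := (EuclideanSpace.single j 1, 0)

/-- The unit vector of the phase space in the direction of the `j`-th momentum. -/
def momentumDir (j : Fin d) : PhaseSpace d := (0, EuclideanSpace.single j 1)

theorem mem_graph_A_iff (j : Fin d) (f g : X) : (f, g) ∈ (W.A j).graph ↔
    HasDerivAt (fun τ : ℝ => W.schrodinger (τ • positionDir j) f) (Complex.I • g) 0 := by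
  simp only [positionDir, schrodinger_single_left, (W.generates_A j).mem_graph]

theorem mem_graph_B_iff (j : Fin d) (f g : X) : (f, g) ∈ (W.B j).graph ↔
    HasDerivAt (fun τ : ℝ => W.schrodinger (τ • momentumDir j) f) (Complex.I • g) 0 := by
  simp only [momentumDir, schrodinger_single_right, (W.generates_B j).mem_graph]

theorem phaseNormSq_positionDir (j : Fin d) : phaseNormSq (positionDir j) = 1 := by
  simp [phaseNormSq, positionDir]

theorem phaseNormSq_momentumDir (j : Fin d) : phaseNormSq (momentumDir j) = 1 := by
  simp [phaseNormSq, momentumDir]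

/-- The kernel of `-(½ (A² + B²) - ½ d)` composed with the smeared operator of the Gaussian
`e^{-b |p|²}`. -/
def oscillatorKernel (b : ℝ) (p : PhaseSpace d) : ℂ :=
  phaseGaussian b p * ((2 * b ^ 2 - 1 / 8) * phaseNormSq p - 2 * b * d + d / 2)

/-- In the sum over all directions the cross terms of position and momentum cancel, so that left
and right multiplication by `½ (A² + B²) - ½ d` give the same kernel. -/
theorem oscillatorKernel_eq {b s : ℝ} (hs : s ^ 2 = 1 / 4) (p : PhaseSpace d) :
    oscillatorKernel b p = (1 / 2 : ℂ) * (∑ j, squareKernel b s (positionDir j) p +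
      ∑ j, squareKernel b s (momentumDir j) p) + (d / 2 : ℂ) * phaseGaussian b p := by
  have hs' : (s : ℂ) ^ 2 = 1 / 4 := by
    rw [← Complex.ofReal_pow, hs]
    norm_num
  have hj : ∀ j : Fin d, squareKernel b s (positionDir j) p + squareKernel b s (momentumDir j) p =
      phaseGaussian b p * ((4 * b ^ 2 - 1 / 4) * ((p.1 j ^ 2 + p.2 j ^ 2 : ℝ) : ℂ) - 4 * b) := by
    intro j
    have h1 : phaseInner (positionDir j) p = p.1 j := by
      simp [phaseInner, positionDir, EuclideanSpace.inner_single_left]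
    have h2 : phaseInner (momentumDir j) p = p.2 j := by
      simp [phaseInner, momentumDir, EuclideanSpace.inner_single_left]
    have h3 : symplecticForm (positionDir j) p = -p.2 j := by
      simp [symplecticForm, positionDir, EuclideanSpace.inner_single_left]
    have h4 : symplecticForm (momentumDir j) p = p.1 j := by
      simp [symplecticForm, momentumDir, EuclideanSpace.inner_single_left]
    simp only [squareKernel, phaseMultiplier, h1, h2, h3, h4]
    push_cast
    linear_combination (phaseGaussian b p * (p.1 j ^ 2 + p.2 j ^ 2 : ℂ)) *
      (s ^ 2 * Complex.I_sq - hs')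
  have hρ : phaseNormSq p = ∑ j, (p.1 j ^ 2 + p.2 j ^ 2) := by
    simp [phaseNormSq, EuclideanSpace.norm_sq_eq, Finset.sum_add_distrib]
  rw [← Finset.sum_add_distrib, Finset.sum_congr rfl fun j _ => hj j, ← Finset.mul_sum,
    Finset.sum_sub_distrib, ← Finset.mul_sum, ← Complex.ofReal_sum, ← hρ]
  simp only [Finset.sum_const, Finset.card_univ, Fintype.card_fin, nsmul_eq_mul, oscillatorKernel]
  ring

theorem smear_oscillatorKernel {b s : ℝ} (hb : 0 < b) (hs : s ^ 2 = 1 / 4) (f : X) :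
    W.smear (oscillatorKernel b) f =
      (1 / 2 : ℂ) • (∑ j, W.smear (squareKernel b s (positionDir j)) f +
        ∑ j, W.smear (squareKernel b s (momentumDir j)) f) +
      (d / 2 : ℂ) • W.smear (phaseGaussian b) f := by
  have hi := fun e : PhaseSpace d => integrable_squareKernel hb s e
  have hA : Integrable fun p => ∑ j : Fin d, squareKernel b s (positionDir j) p :=
    integrable_finsetSum _ fun j _ => hi _
  have hB : Integrable fun p => ∑ j : Fin d, squareKernel b s (momentumDir j) p :=
    integrable_finsetSum _ fun j _ => hi _
  have hAB : Integrable fun p => ∑ j : Fin d, squareKernel b s (positionDir j) p +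
      ∑ j : Fin d, squareKernel b s (momentumDir j) p := hA.add hB
  rw [funext (oscillatorKernel_eq hs), smear_add W (hAB.const_mul _)
      ((integrable_phaseGaussian hb).const_mul _), smear_const_mul, smear_const_mul,
    smear_add W hA hB, smear_finset_sum W _ fun j _ => hi _, smear_finset_sum W _ fun j _ => hi _]

theorem integrable_oscillatorKernel {b : ℝ} (hb : 0 < b) :
    Integrable (oscillatorKernel (d := d) b) := by
  have hs : (1 / 2 : ℝ) ^ 2 = 1 / 4 := by norm_num
  rw [funext (oscillatorKernel_eq hs)]
  exact (((integrable_finsetSum _ fun j _ => integrable_squareKernel hb _ _).add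
    (integrable_finsetSum _ fun j _ => integrable_squareKernel hb _ _)).const_mul _).add
    ((integrable_phaseGaussian hb).const_mul _)

/-- Vectors smeared with a Gaussian lie in the domain of `½ (A² + B²) - ½ d`. -/
theorem smear_mem_graph_preL [CompleteSpace X] {b : ℝ} (hb : 0 < b) (f : X) :
    (W.smear (phaseGaussian b) f, -W.smear (oscillatorKernel b) f) ∈ W.preL.graph := by
  refine (W.mem_graph_preL_iff _ _).2 ⟨_, _,
    fun j => W.smear_mem_graph_sqPMap (W.mem_graph_A_iff j) (phaseNormSq_positionDir j) hb f,
    fun j => W.smear_mem_graph_sqPMap (W.mem_graph_B_iff j) (phaseNormSq_momentumDir j) hb f, ?_⟩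
  rw [W.smear_oscillatorKernel hb (s := 1 / 2) (by norm_num), Finset.sum_neg_distrib,
    Finset.sum_neg_distrib]
  module

/-- The counterpart of `smear_mem_graph_preL` with the operator applied before smearing. No mixed
products such as `A_j B_k` need to be defined on `f`. -/
theorem smear_of_mem_graph_preL {b : ℝ} (hb : 0 < b) {f g : X} (hfg : (f, g) ∈ W.preL.graph) :
    W.smear (phaseGaussian b) g = -W.smear (oscillatorKernel b) f := by
  obtain ⟨x, y, hx, hy, rfl⟩ := (W.mem_graph_preL_iff _ _).1 hfg
  obtain ⟨S, hS⟩ := W.exists_clm_eq_smear (integrable_phaseGaussian (d := d) hb)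
  have hx' := fun j => W.smear_of_mem_graph_sqPMap (W.mem_graph_A_iff j)
    (phaseNormSq_positionDir j) hb (hx j)
  have hy' := fun j => W.smear_of_mem_graph_sqPMap (W.mem_graph_B_iff j)
    (phaseNormSq_momentumDir j) hb (hy j)
  rw [W.smear_oscillatorKernel hb (s := -(1 / 2)) (by norm_num), ← hS, map_sub, map_smul,
    map_smul, map_add, map_sum, map_sum]
  simp only [hS, hx', hy', Finset.sum_neg_distrib]
  module

end WeylPair

/-! ### Families of operators solving an abstract Cauchy problem -/

section Abstract

variable {X : Type*} [NormedAddCommGroup X] [NormedSpace ℂ X]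

theorem tendsto_clm_apply_of_bounded {ι : Type*} {l : Filter ι} {T : ι → X →L[ℂ] X}
    {x : ι → X} {x₀ y : X} {M : ℝ} (hM : ∀ᶠ i in l, ‖T i‖ ≤ M) (hx : Tendsto x l (𝓝 x₀))
    (hT : Tendsto (fun i => T i x₀) l (𝓝 y)) : Tendsto (fun i => T i (x i)) l (𝓝 y) := by
  have h1 : Tendsto (fun i => T i (x i - x₀)) l (𝓝 0) := by
    refine squeeze_zero_norm' (a := fun i => M * ‖x i - x₀‖)
      (hM.mono fun i hi => (T i).le_of_opNorm_le hi _) ?_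
    simpa using ((hx.sub_const x₀).norm).const_mul M
  simpa using h1.add hT

/-- The product rule for a strongly differentiable, locally bounded family of operators. -/
theorem HasDerivAt.clm_apply_of_bounded {T : ℝ → X →L[ℂ] X} {x : ℝ → X} {s₀ : ℝ} {x' y : X}
    {M : ℝ} (hM : ∀ᶠ s in 𝓝 s₀, ‖T s‖ ≤ M) (hx : HasDerivAt x x' s₀)
    (hT : HasDerivAt (fun s => T s (x s₀)) y s₀) (hc : ContinuousAt (fun s => T s x') s₀) :
    HasDerivAt (fun s => T s (x s)) (y + T s₀ x') s₀ := by
  rw [hasDerivAt_iff_tendsto_slope] at hx hT ⊢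
  have h := hT.add (tendsto_clm_apply_of_bounded (hM.filter_mono nhdsWithin_le_nhds) hx
    (hc.tendsto.mono_left nhdsWithin_le_nhds))
  refine h.congr fun s => ?_
  simp only [slope_def_module, map_sub, ContinuousLinearMap.map_smul_of_tower]
  module

/-- A bounded family of operators `P t`, `t > 0`, that tends strongly to the identity as `t ↓ 0`
and solves the Cauchy problem of `-K` from both sides: `d/dt P t f = -K P t f` for all `f`, and
`d/dt P t f = -P t K f` for `f ∈ D(K)`. The operator `Q t` is the derivative of `P t`. -/
structure SolvesCauchyProblem (K : X →ₗ.[ℂ] X) (P Q : ℝ → X →L[ℂ] X) : Prop where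
  bounded : ∃ M : ℝ, ∀ t > 0, ‖P t‖ ≤ M
  tendsto_zero : ∀ f, Tendsto (fun t => P t f) (𝓝[>] 0) (𝓝 f)
  hasDerivAt : ∀ t > 0, ∀ f, HasDerivAt (fun s => P s f) (Q t f) t
  mem_graph : ∀ t > 0, ∀ f, (P t f, -Q t f) ∈ K.graph
  apply_eq : ∀ t > 0, ∀ f g, (f, g) ∈ K.graph → Q t f = -P t g

namespace SolvesCauchyProblem

variable {K : X →ₗ.[ℂ] X} {P Q : ℝ → X →L[ℂ] X} (h : SolvesCauchyProblem K P Q)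
include h

/-- The derivative of `s ↦ P (t - s) P s f` vanishes, whence the semigroup law. -/
theorem apply_apply {s t : ℝ} (hs : 0 < s) (ht : 0 < t) (f : X) :
    P t (P s f) = P (s + t) f := by
  obtain ⟨M, hM⟩ := h.bounded
  set r := s + t with hr
  have hderiv : ∀ u ∈ Set.Ioo 0 r, HasDerivAt (fun u => P (r - u) (P u f)) 0 u := by
    intro u hu
    have hu' : 0 < r - u := by linarith [hu.2]
    have hsub : ∀ x, HasDerivAt (fun v => P (r - v) x) (-Q (r - u) x) u := fun x => by
      exact ((h.hasDerivAt (r - u) hu' x).scomp u ((hasDerivAt_id u).const_sub r)).congr_deriv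
        (by simp)
    have hbd : ∀ᶠ v in 𝓝 u, ‖P (r - v)‖ ≤ M := by
      filter_upwards [Iio_mem_nhds hu.2] with v hv
      exact hM _ (by linarith [Set.mem_Iio.1 hv])
    have key := HasDerivAt.clm_apply_of_bounded hbd (h.hasDerivAt u hu.1 f) (hsub (P u f))
      (hsub (Q u f)).continuousAt
    refine key.congr_deriv ?_
    rw [h.apply_eq _ hu' _ _ (h.mem_graph u hu.1 f)]
    simp
  have hs' : s ∈ Set.Ioo 0 r := ⟨hs, by linarith⟩
  have hconst : ∀ u ∈ Set.Ioo 0 r, P (r - u) (P u f) = P t (P s f) := by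
    intro u hu
    have := isOpen_Ioo.is_const_of_deriv_eq_zero isPreconnected_Ioo
      (fun v hv => (hderiv v hv).differentiableAt.differentiableWithinAt)
      (fun v hv => (hderiv v hv).deriv) hu hs'
    rw [this]
    congr 2
    rw [hr]; ring
  have hr0 : 0 < r := by positivity
  have hlim : Tendsto (fun u => P (r - u) (P u f)) (𝓝[>] 0) (𝓝 (P r f)) := by
    refine tendsto_clm_apply_of_bounded (M := M) ?_ (h.tendsto_zero f) ?_
    · filter_upwards [Ioo_mem_nhdsGT hr0] with u hu
      exact hM _ (by linarith [hu.2])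
    · have h1 : Tendsto (fun u : ℝ => r - u) (𝓝[>] 0) (𝓝 r) := by
        have : Tendsto (fun u : ℝ => r - u) (𝓝 0) (𝓝 (r - 0)) := by
          exact (continuous_const.sub continuous_id).tendsto 0
        rw [sub_zero] at this
        exact this.mono_left nhdsWithin_le_nhds
      exact (h.hasDerivAt r hr0 f).continuousAt.tendsto.comp h1
  refine tendsto_nhds_unique (tendsto_const_nhds.congr' ?_) hlim
  filter_upwards [Ioo_mem_nhdsGT hr0] with u hu
  exact (hconst u hu).symm

/-- Since `P t` and `Q t` are bounded, `Q t = -P t K` extends to the closure of `K`. -/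
theorem apply_eq_of_mem_closure {t : ℝ} (ht : 0 < t) {f g : X}
    (hfg : (f, g) ∈ K.graph.topologicalClosure) : Q t f = -P t g := by
  have hclosed : IsClosed {x : X × X | Q t x.1 = -P t x.2} :=
    isClosed_eq (by fun_prop) (by fun_prop)
  exact closure_minimal (fun x hx => h.apply_eq t ht x.1 x.2 hx) hclosed hfg

theorem hasDerivAt_of_mem_closure {t : ℝ} (ht : 0 < t) {f g : X}
    (hfg : (f, g) ∈ K.graph.topologicalClosure) : HasDerivAt (fun s => P s f) (-P t g) t :=
  h.apply_eq_of_mem_closure ht hfg ▸ h.hasDerivAt t ht f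

theorem tendsto_of_mem_closure {f g : X} (hfg : (f, g) ∈ K.graph.topologicalClosure) :
    Tendsto (fun t : ℝ => t⁻¹ • (P t f - f)) (𝓝[>] 0) (𝓝 (-g)) := by
  -- the orbit, with the value `f` inserted at `0`
  set F : ℝ → X := fun t => if 0 < t then P t f else f with hF
  have hFP : ∀ t > 0, F =ᶠ[𝓝 t] fun s => P s f := fun t ht => by
    filter_upwards [Ioi_mem_nhds ht] with s hs
    exact if_pos hs
  have hd : ∀ t > 0, HasDerivAt F (-P t g) t := fun t ht =>
    (h.hasDerivAt_of_mem_closure ht hfg).congr_of_eventuallyEq (hFP t ht)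
  have hF0 : F 0 = f := if_neg (lt_irrefl _)
  have key : HasDerivWithinAt F (-g) (Set.Ici 0) 0 := by
    refine hasDerivWithinAt_Ici_of_tendsto_deriv (s := Set.Ioi 0)
      (fun t ht => (hd t ht).differentiableAt.differentiableWithinAt) ?_ self_mem_nhdsWithin ?_
    · rw [ContinuousWithinAt, hF0]
      refine (h.tendsto_zero f).congr' ?_
      filter_upwards [self_mem_nhdsWithin] with t ht
      exact (if_pos ht).symm
    · refine (h.tendsto_zero g).neg.congr' ?_
      filter_upwards [self_mem_nhdsWithin] with t ht
      exact (hd t ht).deriv.symm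
  have h2 := (hasDerivWithinAt_iff_tendsto_slope' (lt_irrefl _)).1
    (key.mono Set.Ioi_subset_Ici_self)
  refine h2.congr' ?_
  filter_upwards [self_mem_nhdsWithin] with t ht
  rw [slope_def_module, hF0, sub_zero, show F t = P t f from if_pos ht]

theorem isClosable : K.IsClosable := by
  refine ⟨K.graph.topologicalClosure.toLinearPMap, ?_⟩
  refine (Submodule.toLinearPMap_graph_eq _ ?_).symm
  rintro ⟨f, g⟩ hfg (rfl : f = 0)
  have h1 := h.tendsto_of_mem_closure hfg
  simp only [map_zero, sub_zero, smul_zero] at h1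
  exact neg_eq_zero.1 (tendsto_nhds_unique tendsto_const_nhds h1).symm

theorem mem_graph_closure {f g : X} :
    (f, g) ∈ K.closure.graph ↔ (f, g) ∈ K.graph.topologicalClosure := by
  rw [h.isClosable.graph_closure_eq_closure_graph]

/-- The domain of `K` is a core of the generator, because it contains the range of each `P s`. -/
theorem isGeneratorOf_neg_closure : IsGeneratorOf (-K.closure) P := by
  obtain ⟨M, hM⟩ := h.bounded
  intro f g
  rw [mem_graph_neg_iff, h.mem_graph_closure]
  refine ⟨fun hfg => by simpa using h.tendsto_of_mem_closure hfg, fun hlim => ?_⟩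
  -- `P s f` lies in the domain of `K`, with `K P s f = -P s g`; now let `s ↓ 0`
  have hmem : ∀ s > 0, (P s f, -P s g) ∈ K.graph := by
    intro s hs
    have h1 : Tendsto (fun t : ℝ => t⁻¹ • (P t (P s f) - P s f)) (𝓝[>] 0) (𝓝 (Q s f)) := by
      simpa using h.tendsto_of_mem_closure (subset_closure (h.mem_graph s hs f))
    have h2 : Tendsto (fun t : ℝ => t⁻¹ • (P t (P s f) - P s f)) (𝓝[>] 0) (𝓝 (P s g)) := by
      refine (((P s).continuous.tendsto g).comp hlim).congr' ?_
      filter_upwards [self_mem_nhdsWithin] with t ht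
      rw [Function.comp_apply, ContinuousLinearMap.map_smul_of_tower, map_sub, h.apply_apply ht hs,
        h.apply_apply hs ht, add_comm]
    rw [← tendsto_nhds_unique h1 h2]
    exact h.mem_graph s hs f
  refine mem_closure_of_tendsto ((h.tendsto_zero f).prodMk_nhds (h.tendsto_zero g).neg) ?_
  filter_upwards [self_mem_nhdsWithin] with s hs
  exact hmem s hs

variable {π : X →L[ℂ] X} (hπ : ∀ f, Tendsto (fun t => P t f) atTop (𝓝 (π f)))
include hπ

theorem nullSpace_closure_eq_range :
    nullSpace K.closure = LinearMap.range (π : X →ₗ[ℂ] X) := by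
  ext f
  rw [mem_nullSpace_iff, LinearMap.mem_range]
  constructor
  · intro hf
    rw [h.mem_graph_closure] at hf
    have hd : ∀ t > 0, HasDerivAt (fun s => P s f) 0 t := fun t ht => by
      simpa using h.hasDerivAt_of_mem_closure ht hf
    have hconst : ∀ t > 0, P t f = P 1 f := fun t ht =>
      isOpen_Ioi.is_const_of_deriv_eq_zero isPreconnected_Ioi
        (fun v hv => (hd v hv).differentiableAt.differentiableWithinAt)
        (fun v hv => (hd v hv).deriv) ht (Set.mem_Ioi.2 one_pos)
    have h1 : Tendsto (fun t => P t f) (𝓝[>] 0) (𝓝 (P 1 f)) :=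
      tendsto_const_nhds.congr' (by
        filter_upwards [self_mem_nhdsWithin] with t ht using (hconst t ht).symm)
    have h2 : Tendsto (fun t => P t f) atTop (𝓝 (P 1 f)) :=
      tendsto_const_nhds.congr' (by
        filter_upwards [eventually_gt_atTop 0] with t ht using (hconst t ht).symm)
    refine ⟨f, ?_⟩
    change π f = f
    rw [tendsto_nhds_unique (hπ f) h2, tendsto_nhds_unique h1 (h.tendsto_zero f)]
  · rintro ⟨g, rfl⟩
    change (π g, (0 : X)) ∈ _
    have hfix : ∀ t > 0, P t (π g) = π g := by
      intro t ht
      refine tendsto_nhds_unique (((P t).continuous.tendsto _).comp (hπ g)) ?_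
      refine ((hπ g).comp (tendsto_atTop_add_const_right _ t tendsto_id)).congr' ?_
      filter_upwards [eventually_gt_atTop 0] with s hs
      exact (h.apply_apply hs ht g).symm
    have := (h.isGeneratorOf_neg_closure (π g) 0).2 (tendsto_const_nhds.congr' (by
      filter_upwards [self_mem_nhdsWithin] with t ht
      rw [hfix t ht, sub_self, smul_zero]))
    simpa [mem_graph_neg_iff] using this

theorem closure_rangeSpace_closure_eq_ker :
    (rangeSpace K.closure).topologicalClosure = LinearMap.ker (π : X →ₗ[ℂ] X) := by
  have hcomm : ∀ t > 0, ∀ f, π (P t f) = π f := by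
    intro t ht f
    refine tendsto_nhds_unique (hπ (P t f)) ?_
    refine ((hπ f).comp (tendsto_atTop_add_const_left _ t tendsto_id)).congr' ?_
    filter_upwards [eventually_gt_atTop 0] with s hs
    exact (h.apply_apply ht hs f).symm
  apply le_antisymm
  · refine Submodule.topologicalClosure_minimal _ ?_ π.isClosed_ker
    intro g hg
    obtain ⟨f, hf⟩ := (mem_rangeSpace_iff _ _).1 hg
    rw [h.mem_graph_closure] at hf
    change π g = 0
    have h1 := ((π.continuous.tendsto _).comp (h.tendsto_of_mem_closure hf))
    have h2 : Tendsto (π ∘ fun t : ℝ => t⁻¹ • (P t f - f)) (𝓝[>] 0) (𝓝 0) :=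
      tendsto_const_nhds.congr' (by
        filter_upwards [self_mem_nhdsWithin] with t ht
        rw [Function.comp_apply, ContinuousLinearMap.map_smul_of_tower, map_sub, hcomm t ht,
          sub_self, smul_zero])
    simpa using tendsto_nhds_unique h1 h2
  · intro f hf
    have hf0 : π f = 0 := hf
    -- modulo the closed range of `K.closure`, the orbit of `f` is constant
    set S := (rangeSpace K.closure).topologicalClosure with hS
    have : IsClosed (S : Set X) := Submodule.isClosed_topologicalClosure _
    have hd : ∀ t > 0, HasDerivAt (fun s => S.mkQL (P s f)) 0 t := by
      intro t ht
      have h1 := (S.mkQL.restrictScalars ℝ).hasFDerivAt.comp_hasDerivAt t (h.hasDerivAt t ht f)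
      refine h1.congr_deriv ?_
      change S.mkQ (Q t f) = 0
      rw [Submodule.mkQ_apply, Submodule.Quotient.mk_eq_zero, ← S.neg_mem_iff]
      exact subset_closure ((mem_rangeSpace_iff _ _).2 ⟨_, h.mem_graph_closure.2
        (subset_closure (h.mem_graph t ht f))⟩)
    have hconst : ∀ t > 0, S.mkQL (P t f) = S.mkQL (P 1 f) := fun t ht =>
      isOpen_Ioi.is_const_of_deriv_eq_zero isPreconnected_Ioi
        (fun v hv => (hd v hv).differentiableAt.differentiableWithinAt)
        (fun v hv => (hd v hv).deriv) ht (Set.mem_Ioi.2 one_pos)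
    have h1 : S.mkQL f = S.mkQL (P 1 f) :=
      tendsto_nhds_unique ((S.mkQL.continuous.tendsto _).comp (h.tendsto_zero f))
        (tendsto_const_nhds.congr' (by
          filter_upwards [self_mem_nhdsWithin] with t ht using (hconst t ht).symm))
    have h2 : S.mkQL (π f) = S.mkQL (P 1 f) :=
      tendsto_nhds_unique ((S.mkQL.continuous.tendsto _).comp (hπ f))
        (tendsto_const_nhds.congr' (by
          filter_upwards [eventually_gt_atTop 0] with t ht using (hconst t ht).symm))
    rw [← h2, hf0, map_zero] at h1
    exact (Submodule.Quotient.mk_eq_zero S).1 h1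

end SolvesCauchyProblem

end Abstract

/-! ### The Mehler parameter -/

section MehlerParameter

theorem mehlerLambda_pos {t : ℝ} (ht : 0 < t) : 0 < mehlerLambda t := by
  have h1 : Real.exp (-t) < 1 := by
    rw [← Real.exp_zero]
    exact Real.exp_lt_exp.2 (by linarith)
  have h2 := Real.exp_pos (-t)
  exact div_pos (by linarith) (by linarith)

theorem mehlerLambda_le_one (t : ℝ) : mehlerLambda t ≤ 1 := by
  have h2 := Real.exp_pos (-t)
  rw [mehlerLambda, div_le_one (by linarith)]
  linarith

theorem hasDerivAt_mehlerLambda (t : ℝ) :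
    HasDerivAt mehlerLambda ((1 - mehlerLambda t ^ 2) / 2) t := by
  have h2 := Real.exp_pos (-t)
  have h3 : HasDerivAt (fun t : ℝ => Real.exp (-t)) (-Real.exp (-t)) t := by
    simpa using (hasDerivAt_neg t).exp
  refine ((h3.const_sub 1).div (h3.const_add 1) (by linarith)).congr_deriv ?_
  rw [mehlerLambda]
  field_simp
  ring

theorem tendsto_mehlerLambda_zero : Tendsto mehlerLambda (𝓝[>] 0) (𝓝 0) := by
  have h := (hasDerivAt_mehlerLambda 0).continuousAt.tendsto
  have h0 : mehlerLambda 0 = 0 := by simp [mehlerLambda]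
  rw [h0] at h
  exact h.mono_left nhdsWithin_le_nhds

theorem tendsto_mehlerLambda_atTop : Tendsto mehlerLambda atTop (𝓝 1) := by
  have h : Tendsto (fun t : ℝ => Real.exp (-t)) atTop (𝓝 0) := Real.tendsto_exp_neg_atTop_nhds_zero
  have h1 : Tendsto mehlerLambda atTop (𝓝 ((1 - 0) / (1 + 0))) :=
    (h.const_sub 1).div (h.const_add 1) (by norm_num)
  simpa using h1

end MehlerParameter

/-! ### The Weyl calculus of the Mehler symbols -/

section FourierTransform

variable {d : ℕ}

/-- The Fourier transform of a Gaussian is a Gaussian: the integral splits into two Gaussian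
integrals over `ℝ^d`. -/
theorem fourierPlancherel_mehlerSymbol {t : ℝ} (ht : 0 < t) (p : PhaseSpace d) :
    fourierPlancherel (mehlerSymbol d t) p =
      (((1 + mehlerLambda t) / (2 * mehlerLambda t)) ^ d : ℝ) *
        phaseGaussian (1 / (4 * mehlerLambda t)) p := by
  have hl := mehlerLambda_pos ht
  set l := mehlerLambda t with hl_def
  have hl' : (l : ℂ) ≠ 0 := by exact_mod_cast hl.ne'
  have hπ : (Real.pi : ℂ) ≠ 0 := by exact_mod_cast Real.pi_ne_zero
  have hG := fun w : EuclideanSpace ℝ (Fin d) =>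
    GaussianFourier.integral_cexp_neg_mul_sq_norm_add (b := (l : ℂ)) (by simpa using hl)
      (-Complex.I) w
  have hint : ∫ q : PhaseSpace d, mehlerSymbol d t q *
        Complex.exp (-Complex.I * ((inner ℝ q.1 p.1 + inner ℝ q.2 p.2 : ℝ) : ℂ)) =
      ((1 + l) ^ d : ℝ) *
        ((∫ v, Complex.exp (-l * ‖v‖ ^ 2 + -Complex.I * (inner ℝ p.1 v : ℝ))) *
          ∫ v, Complex.exp (-l * ‖v‖ ^ 2 + -Complex.I * (inner ℝ p.2 v : ℝ))) := by
    rw [← integral_prod_mul, ← integral_const_mul]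
    refine integral_congr_ae (Eventually.of_forall fun q => ?_)
    simp only [mehlerSymbol, ← hl_def, Complex.ofReal_mul, Complex.ofReal_exp, mul_assoc,
      ← Complex.exp_add, real_inner_comm p.1 q.1, real_inner_comm p.2 q.2]
    congr 2
    push_cast
    ring
  have hpow : ((Real.pi : ℂ) / l) ^ ((d : ℂ) / 2) * ((Real.pi : ℂ) / l) ^ ((d : ℂ) / 2) =
      ((Real.pi : ℂ) / l) ^ d := by
    rw [← Complex.cpow_add _ _ (div_ne_zero hπ hl'), add_halves, Complex.cpow_natCast]
  rw [fourierPlancherel, hint, hG, hG, finrank_euclideanSpace_fin, phaseGaussian_eq_mul]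
  have hexp : ∀ w : EuclideanSpace ℝ (Fin d), (-Complex.I) ^ 2 * (‖w‖ : ℂ) ^ 2 / (4 * l) =
      -((1 / (4 * l) : ℝ) : ℂ) * ‖w‖ ^ 2 := by
    intro w
    rw [neg_sq, Complex.I_sq]
    push_cast
    ring
  rw [hexp, hexp, mul_mul_mul_comm, hpow, ← mul_assoc, ← mul_assoc]
  congr 1
  push_cast
  rw [← inv_pow, ← mul_pow, ← mul_pow]
  congr 1
  field_simp

theorem integrable_fourierPlancherel_mehlerSymbol {t : ℝ} (ht : 0 < t) :
    Integrable (fourierPlancherel (mehlerSymbol d t)) := by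
  have hl := mehlerLambda_pos ht
  rw [funext (fourierPlancherel_mehlerSymbol ht)]
  exact (integrable_phaseGaussian (by positivity)).const_mul _

end FourierTransform

namespace WeylPair

variable {d : ℕ} {X : Type*} [NormedAddCommGroup X] [NormedSpace ℂ X] (W : WeylPair d X)

/-- The factor in front of the Gaussian kernel of the Mehler operator with parameter `l`. -/
def mehlerFactor (d : ℕ) (l : ℝ) : ℝ := ((2 * Real.pi) ^ d)⁻¹ * ((1 + l) / (2 * l)) ^ d

theorem weyl_mehlerSymbol {t : ℝ} (ht : 0 < t) (f : X) :
    W.weyl (mehlerSymbol d t) f = mehlerFactor d (mehlerLambda t) •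
      W.smear (phaseGaussian (1 / (4 * mehlerLambda t))) f := by
  rw [weyl, dif_pos (integrable_fourierPlancherel_mehlerSymbol ht)]
  change ((2 * Real.pi : ℝ) ^ d : ℂ)⁻¹ • W.smear (fourierPlancherel (mehlerSymbol d t)) f = _
  rw [funext (fourierPlancherel_mehlerSymbol ht), smear_const_mul, smul_smul, mehlerFactor,
    ← Complex.coe_smul]
  congr 1
  push_cast
  ring

/-- The Mehler operator with parameter `l`, written as an average of Weyl operators against a
fixed Gaussian; this makes sense for `l = 0` as well. -/
def mehlerAverage (l : ℝ) (f : X) : X :=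
  ((1 + l) / Real.pi) ^ d • ∫ q : PhaseSpace d, phaseGaussian 1 q •
    W.schrodinger ((2 * √l) • q) f

/-- The substitution `p = 2 √l q` in the integral with the Gaussian kernel `e^{-|p|² / (4 l)}`. -/
theorem mehlerAverage_eq_smear {l : ℝ} (hl : 0 < l) (f : X) :
    W.mehlerAverage l f = mehlerFactor d l • W.smear (phaseGaussian (1 / (4 * l))) f := by
  have hsq : √l ^ 2 = l := Real.sq_sqrt hl.le
  have hG : ∀ q : PhaseSpace d, phaseGaussian (1 / (4 * l)) ((2 * √l) • q) =
      phaseGaussian 1 q := by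
    intro q
    simp only [phaseGaussian, phaseNormSq, Prod.smul_fst, Prod.smul_snd, norm_smul, mul_pow,
      Real.norm_eq_abs, sq_abs, hsq]
    congr 2
    field_simp
    ring
  have h := Measure.integral_comp_smul (volume : Measure (PhaseSpace d))
    (fun p => phaseGaussian (1 / (4 * l)) p • W.schrodinger p f) (2 * √l)
  simp only [hG] at h
  rw [mehlerAverage, h, smul_smul, mehlerFactor, smear]
  congr 1
  rw [Module.finrank_prod, finrank_euclideanSpace_fin, ← two_mul, pow_mul, mul_pow, hsq,
    abs_of_pos (by positivity), ← inv_pow, ← inv_pow, ← mul_pow, ← mul_pow]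
  congr 1
  have := Real.pi_pos
  field_simp

theorem weyl_mehlerSymbol_eq_average {t : ℝ} (ht : 0 < t) (f : X) :
    W.weyl (mehlerSymbol d t) f = W.mehlerAverage (mehlerLambda t) f := by
  rw [weyl_mehlerSymbol W ht, mehlerAverage_eq_smear W (mehlerLambda_pos ht)]

theorem mehlerAverage_zero [CompleteSpace X] (f : X) : W.mehlerAverage 0 f = f := by
  have h1 : ∫ q : PhaseSpace d, phaseGaussian 1 q = (Real.pi : ℂ) ^ d := by
    have h := GaussianFourier.integral_cexp_neg_mul_sq_norm_add (b := 1)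
      (V := EuclideanSpace ℝ (Fin d)) (by simp) 0 0
    simp only [zero_mul, add_zero, finrank_euclideanSpace_fin, div_one, ne_eq,
      OfNat.ofNat_ne_zero, not_false_eq_true, zero_pow, zero_div, Complex.exp_zero, mul_one] at h
    simp only [phaseGaussian_eq_mul, Complex.ofReal_one]
    rw [Measure.volume_eq_prod, integral_prod_mul
      (fun v : EuclideanSpace ℝ (Fin d) => Complex.exp (-1 * ‖v‖ ^ 2))
      (fun v : EuclideanSpace ℝ (Fin d) => Complex.exp (-1 * ‖v‖ ^ 2)), h,
      ← Complex.cpow_add _ _ (by exact_mod_cast Real.pi_ne_zero), add_halves,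
      Complex.cpow_natCast]
  simp only [mehlerAverage, Real.sqrt_zero, mul_zero, zero_smul, schrodinger_zero,
    one_apply_eq_self, add_zero]
  rw [integral_smul_const, h1, ← Complex.coe_smul, smul_smul]
  push_cast
  rw [← mul_pow, one_div, inv_mul_cancel₀ (by exact_mod_cast Real.pi_ne_zero), one_pow, one_smul]

theorem continuous_mehlerAverage (f : X) : Continuous fun l => W.mehlerAverage l f := by
  obtain ⟨M, hM⟩ := W.schrodinger_bounded
  have hW := W.schrodinger_continuous f
  have hc : Continuous fun l : ℝ => ((1 + l) / Real.pi) ^ d := by fun_prop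
  refine hc.smul ?_
  refine continuous_of_dominated (bound := fun q => ‖phaseGaussian 1 q‖ * (M * ‖f‖))
    (fun l => Continuous.aestronglyMeasurable ?_) (fun l => Eventually.of_forall fun q => ?_)
    ((integrable_phaseGaussian one_pos).norm.mul_const _) (Eventually.of_forall fun q => ?_)
  · exact (continuous_phaseGaussian 1).smul (hW.comp (by fun_prop))
  · rw [norm_smul]
    exact mul_le_mul_of_nonneg_left ((W.schrodinger _).le_of_opNorm_le (hM _) f) (norm_nonneg _)
  · exact (hW.comp (by fun_prop : Continuous fun l : ℝ => (2 * √l) • q)).const_smul _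

theorem exists_norm_mehlerAverage_le :
    ∃ M : ℝ, 0 ≤ M ∧ ∀ l, 0 ≤ l → l ≤ 1 → ∀ f, ‖W.mehlerAverage l f‖ ≤ M * ‖f‖ := by
  obtain ⟨M, hM⟩ := W.schrodinger_bounded
  have hM0 : 0 ≤ M := (norm_nonneg _).trans (hM 0)
  have hi : 0 ≤ ∫ q : PhaseSpace d, ‖phaseGaussian 1 q‖ :=
    integral_nonneg fun _ => norm_nonneg _
  have hpi := Real.pi_pos
  refine ⟨(2 / Real.pi) ^ d * ((∫ q : PhaseSpace d, ‖phaseGaussian 1 q‖) * M), by positivity,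
    fun l hl hl1 f => ?_⟩
  have h1 : ‖∫ q : PhaseSpace d, phaseGaussian 1 q • W.schrodinger ((2 * √l) • q) f‖ ≤
      (∫ q : PhaseSpace d, ‖phaseGaussian 1 q‖) * M * ‖f‖ := by
    rw [mul_assoc, ← integral_mul_const]
    refine norm_integral_le_of_norm_le
      ((integrable_phaseGaussian one_pos).norm.mul_const _) (Eventually.of_forall fun q => ?_)
    rw [norm_smul]
    exact mul_le_mul_of_nonneg_left ((W.schrodinger _).le_of_opNorm_le (hM _) f) (norm_nonneg _)
  have h2 : ((1 + l) / Real.pi) ^ d ≤ (2 / Real.pi) ^ d := by gcongr; linarith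
  rw [mehlerAverage, norm_smul, Real.norm_of_nonneg (by positivity), mul_assoc]
  exact mul_le_mul h2 h1 (norm_nonneg _) (by positivity)

theorem smear_oscillatorKernel_eq {b : ℝ} (hb : 0 < b) (f : X) :
    W.smear (oscillatorKernel b) f =
      ((1 / 8 - 2 * b ^ 2 : ℝ) : ℂ) •
        W.smear (fun p => phaseGaussian b p * -(phaseNormSq p : ℂ)) f +
      ((d / 2 - 2 * b * d : ℝ) : ℂ) • W.smear (phaseGaussian b) f := by
  have hi : Integrable fun p : PhaseSpace d => phaseGaussian b p * -(phaseNormSq p : ℂ) := by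
    refine (integrable_gaussian_mul_phaseNormSq hb).mono' (by fun_prop)
      (Eventually.of_forall fun p => ?_)
    rw [norm_mul, norm_neg, Complex.norm_real, norm_phaseGaussian,
      Real.norm_of_nonneg (phaseNormSq_nonneg p)]
  rw [← smear_const_mul, ← smear_const_mul, ← smear_add W (hi.const_mul _)
    ((integrable_phaseGaussian hb).const_mul _)]
  congr 1
  ext p
  rw [oscillatorKernel]
  push_cast
  ring

theorem hasDerivAt_smear_phaseGaussian {b : ℝ} (hb : 0 < b) (f : X) :
    HasDerivAt (fun b => W.smear (phaseGaussian b) f)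
      (W.smear (fun p => phaseGaussian b p * -(phaseNormSq p : ℂ)) f) b := by
  have hi : Integrable fun p : PhaseSpace d => ‖phaseGaussian b p‖ * ‖-(phaseNormSq p : ℂ)‖ *
      Real.exp (b / 2 * ‖-(phaseNormSq p : ℂ)‖) := by
    refine (integrable_gaussian_mul_phaseNormSq (half_pos hb)).congr
      (Eventually.of_forall fun p => ?_)
    simp only [norm_neg, Complex.norm_real, norm_phaseGaussian,
      Real.norm_of_nonneg (phaseNormSq_nonneg p)]
    rw [mul_right_comm, ← Real.exp_add]
    ring_nf
  -- near `b`, the Gaussian with parameter `c` is `e^{-b |p|²} e^{-(c - b) |p|²}`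
  have h := W.hasDerivAt_smear_exp (κ := phaseGaussian b) (m := fun p => -(phaseNormSq p : ℂ))
    (by fun_prop) (by fun_prop) (integrable_phaseGaussian hb) (half_pos hb) hi f
  have h2 : HasDerivAt (fun c : ℝ => c - b) 1 b := (hasDerivAt_id b).sub_const b
  rw [← sub_self b] at h
  refine ((h.scomp (h := fun c => c - b) b h2).congr_deriv (one_smul _ _)).congr_of_eventuallyEq
    (Eventually.of_forall fun c => ?_)
  simp only [Function.comp_apply]
  congr 1
  ext p
  simp only [phaseGaussian, Complex.ofReal_exp, ← Complex.exp_add]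
  congr 1
  push_cast
  ring

/-- The derivative of the factor is its multiple by the constant term `½ d - 2 b d`, where
`b = 1 / (4 λ_t)`, of the polynomial in `oscillatorKernel b`. -/
theorem hasDerivAt_mehlerFactor (d : ℕ) {t : ℝ} (ht : 0 < t) :
    HasDerivAt (fun s => mehlerFactor d (mehlerLambda s))
      (mehlerFactor d (mehlerLambda t) *
        (d / 2 - 2 * (1 / (4 * mehlerLambda t)) * d)) t := by
  have hl := mehlerLambda_pos ht
  have h1 := hasDerivAt_mehlerLambda t
  have h2 := (((h1.const_add 1).div (h1.const_mul 2) (by positivity)).pow d).const_mul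
    (((2 * Real.pi) ^ d)⁻¹)
  refine h2.congr_deriv ?_
  rw [mehlerFactor]
  rcases d with _ | d
  · simp
  · simp only [Nat.add_sub_cancel, pow_succ ((1 + mehlerLambda t) / (2 * mehlerLambda t))]
    simp only [Pi.div_apply]
    field_simp
    ring

/-- The Mehler operators solve the heat equation of the harmonic oscillator. -/
theorem hasDerivAt_weyl_mehlerSymbol {t : ℝ} (ht : 0 < t) (f : X) :
    HasDerivAt (fun s => W.weyl (mehlerSymbol d s) f)
      (mehlerFactor d (mehlerLambda t) •
        W.smear (oscillatorKernel (1 / (4 * mehlerLambda t))) f) t := by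
  have hl := mehlerLambda_pos ht
  have hb : 0 < 1 / (4 * mehlerLambda t) := by positivity
  have h1 : HasDerivAt (fun s => 1 / (4 * mehlerLambda s))
      (1 / 8 - 2 * (1 / (4 * mehlerLambda t)) ^ 2) t := by
    -- by `λ' = ½ (1 - λ²)`
    refine ((((hasDerivAt_mehlerLambda t).const_mul 4).inv
      (by positivity)).congr_deriv ?_).congr_of_eventuallyEq
      (Eventually.of_forall fun s => one_div _)
    field_simp
    ring
  have h2 := (hasDerivAt_mehlerFactor d ht).smul
    ((W.hasDerivAt_smear_phaseGaussian hb f).scomp t h1)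
  refine (h2.congr_deriv ?_).congr_of_eventuallyEq ?_
  · rw [W.smear_oscillatorKernel_eq hb, Complex.coe_smul, Complex.coe_smul, smul_add, smul_smul,
      smul_smul]
    rfl
  · filter_upwards [Ioi_mem_nhds ht] with s hs
    exact W.weyl_mehlerSymbol hs f

/-- The Mehler operators satisfy the hypotheses of the abstract Cauchy problem for
`½ (A² + B²) - ½ d`. -/
theorem exists_solvesCauchyProblem [CompleteSpace X] :
    ∃ Q, SolvesCauchyProblem W.preL (fun t => W.weyl (mehlerSymbol d t)) Q := by
  have hb : ∀ t > 0, 0 < 1 / (4 * mehlerLambda t) := fun t ht => by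
    have := mehlerLambda_pos ht
    positivity
  have hQ : ∀ t, ∃ Q : X →L[ℂ] X, 0 < t → ∀ f, Q f = mehlerFactor d (mehlerLambda t) •
      W.smear (oscillatorKernel (1 / (4 * mehlerLambda t))) f := by
    intro t
    by_cases ht : 0 < t
    · obtain ⟨T, hT⟩ := W.exists_clm_eq_smear (integrable_oscillatorKernel (d := d) (hb t ht))
      exact ⟨(mehlerFactor d (mehlerLambda t) : ℂ) • T, fun _ f => by
        simp only [smul_apply, hT, Complex.coe_smul]⟩
    · exact ⟨0, fun h => absurd h ht⟩
  choose Q hQ using hQ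
  refine ⟨Q, ⟨?_, fun f => ?_, fun t ht f => ?_, fun t ht f => ?_, fun t ht f g hfg => ?_⟩⟩
  · obtain ⟨M, hM0, hM⟩ := W.exists_norm_mehlerAverage_le
    refine ⟨M, fun t ht => ContinuousLinearMap.opNorm_le_bound _ hM0 fun f => ?_⟩
    rw [W.weyl_mehlerSymbol_eq_average ht]
    exact hM _ (mehlerLambda_pos ht).le (mehlerLambda_le_one t) f
  · have h := ((W.continuous_mehlerAverage f).tendsto 0).comp tendsto_mehlerLambda_zero
    rw [W.mehlerAverage_zero] at h
    refine h.congr' ?_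
    filter_upwards [self_mem_nhdsWithin] with t ht
    exact (W.weyl_mehlerSymbol_eq_average ht f).symm
  · rw [hQ t ht]
    exact W.hasDerivAt_weyl_mehlerSymbol ht f
  · rw [hQ t ht, W.weyl_mehlerSymbol ht, ← smul_neg, ← Complex.coe_smul, ← Complex.coe_smul]
    exact W.preL.graph.smul_mem _ (W.smear_mem_graph_preL (hb t ht) f)
  · rw [hQ t ht, W.weyl_mehlerSymbol ht, W.smear_of_mem_graph_preL (hb t ht) hfg, smul_neg,
      neg_neg]

/-- The strong limit of the Mehler operators is the average with parameter `l = 1`. -/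
theorem exists_tendsto_weyl_mehlerSymbol :
    ∃ π : X →L[ℂ] X, ∀ f, Tendsto (fun t => W.weyl (mehlerSymbol d t) f) atTop (𝓝 (π f)) := by
  obtain ⟨T, hT⟩ := W.exists_clm_eq_smear
    (integrable_phaseGaussian (d := d) (b := 1 / (4 * 1)) (by norm_num))
  refine ⟨(mehlerFactor d 1 : ℂ) • T, fun f => ?_⟩
  have h := ((W.continuous_mehlerAverage f).tendsto 1).comp tendsto_mehlerLambda_atTop
  rw [W.mehlerAverage_eq_smear one_pos, ← hT, ← Complex.coe_smul] at h
  refine h.congr' ?_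
  filter_upwards [eventually_gt_atTop 0] with t ht
  exact (W.weyl_mehlerSymbol_eq_average ht f).symm

end WeylPair

end

theorem mainTheorem10 {d : ℕ} {X : Type*} [NormedAddCommGroup X] [NormedSpace ℂ X]
    [CompleteSpace X] (hX : IsReflexiveSpace X) (W : WeylPair d X) :
    W.preL.IsClosable ∧
    IsGeneratorOf (-W.L) (fun t => W.weyl (mehlerSymbol d t)) ∧
    ∃ π : X →L[ℂ] X,
      Tendsto (fun t : ℝ => ContinuousLinearMapWOT.ofCLM (W.weyl (mehlerSymbol d t))) atTop
        (𝓝 (ContinuousLinearMapWOT.ofCLM π)) ∧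
      nullSpace W.L = LinearMap.range (π : X →ₗ[ℂ] X) ∧
      (rangeSpace W.L).topologicalClosure = LinearMap.ker (π : X →ₗ[ℂ] X) := by
  obtain ⟨Q, h⟩ := W.exists_solvesCauchyProblem
  obtain ⟨π, hπ⟩ := W.exists_tendsto_weyl_mehlerSymbol
  refine ⟨h.isClosable, h.isGeneratorOf_neg_closure, π, ?_, h.nullSpace_closure_eq_range hπ,
    h.closure_rangeSpace_closure_eq_ker hπ⟩
  rw [ContinuousLinearMapWOT.tendsto_iff_forall_dual_apply_tendsto]
  exact fun f φ => (φ.continuous.tendsto _).comp (hπ f)
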